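/- Let $d\ge 1$ and let $R=\prod_{i=1}^d[\mathrm{lo}_i,\mathrm{hi}_i]\subset\mathbb{R}^d$, with $\mathrm{lo}_i<\mathrm{hi}_i$ for all $i$, be an axis-parallel box containing $n\ge 2$ given points. A box means a nonempty open axis-parallel box $\prod_{i=1}^d(l_i,h_i)$; it is called empty if it contains none of the given points. The model of computation is the real RAM: memory cells hold real numbers, and each arithmetic operation $+,-,\times,/$, comparison, floor operation, and (indirectly addressed) memory access costs one step. Then there are a single real-RAM program and an absolute constant $C$ such that for all $d\ge 1$, $n\ge 2$, all $\varepsilon\in(0,1)$ and all such $R$ and points, the program, given $d$, $n$, $\varepsilon$, $R$ and the $n$ points as input, halts after at most $$C\cdot\left(\frac{8ed}{\varepsilon^2}\right)^d\cdot n\cdot\log_2^d n$$ steps and outputs an empty box contained in $R$ whose volume is at least $(1-\varepsilon)$ times the maximum volume of an empty box contained in $R$. -/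

import Mathlib

/-! ## The machine: a real RAM with unit-cost arithmetic, comparisons, floor and indirect addressing

A program is a fixed finite object, independent of the input.  Every memory cell holds one real
number; the memory is organised in arrays (finitely many of which occur in a given program), and
the cells of an array are addressed by integers computed at run time. -/

namespace RealRAM

/-- A memory content: `σ a i` is the number in cell `i` of array `a`. -/
abbrev State : Type := ℕ → ℤ → ℝ

/-- Arithmetic expressions.  `get a e` reads the cell of array `a` whose address is the value of
`e` (rounded down if it is not an integer).  The only constants are integers. -/
inductive Expr : Type
  | const (z : ℤ)
  | get (a : ℕ) (e : Expr)
  | add (e f : Expr)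
  | sub (e f : Expr)
  | mul (e f : Expr)
  | div (e f : Expr)
  | floor (e : Expr)

/-- The value of an expression (with the convention `x / 0 = 0`). -/
noncomputable def Expr.eval (σ : State) : Expr → ℝ
  | .const z => (z : ℝ)
  | .get a e => σ a ⌊e.eval σ⌋
  | .add e f => e.eval σ + f.eval σ
  | .sub e f => e.eval σ - f.eval σ
  | .mul e f => e.eval σ * f.eval σ
  | .div e f => e.eval σ / f.eval σ
  | .floor e => (⌊e.eval σ⌋ : ℝ)

/-- The number of elementary operations (constants, memory reads, arithmetic operations and floors)
performed when an expression is evaluated. -/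
def Expr.cost : Expr → ℕ
  | .const _ => 1
  | .get _ e => e.cost + 1
  | .add e f => e.cost + f.cost + 1
  | .sub e f => e.cost + f.cost + 1
  | .mul e f => e.cost + f.cost + 1
  | .div e f => e.cost + f.cost + 1
  | .floor e => e.cost + 1

/-- Tests. -/
inductive Cond : Type
  | lt (e f : Expr)
  | le (e f : Expr)
  | and (b c : Cond)
  | not (b : Cond)

/-- The truth of a test in a memory content. -/
def Cond.Holds (σ : State) : Cond → Prop
  | .lt e f => e.eval σ < f.eval σ
  | .le e f => e.eval σ ≤ f.eval σ
  | .and b c => b.Holds σ ∧ c.Holds σ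
  | .not b => ¬ b.Holds σ

/-- The number of elementary operations performed in a test. -/
def Cond.cost : Cond → ℕ
  | .lt e f => e.cost + f.cost + 1
  | .le e f => e.cost + f.cost + 1
  | .and b c => b.cost + c.cost + 1
  | .not b => b.cost + 1

/-- Programs.  `set a e f` writes the value of `f` into the cell of array `a` whose address is the
value of `e` (rounded down if it is not an integer). -/
inductive Prog : Type
  | skip
  | set (a : ℕ) (e f : Expr)
  | seq (P Q : Prog)
  | ite (b : Cond) (P Q : Prog)
  | while (b : Cond) (P : Prog)

/-- The memory content after writing `x` into cell `i` of array `a`. -/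
noncomputable def State.write (σ : State) (a : ℕ) (i : ℤ) (x : ℝ) : State :=
  Function.update σ a (Function.update (σ a) i x)

/-- `Exec P σ t τ`: started in memory content `σ`, the program `P` halts after exactly `t`
elementary steps, with memory content `τ`.  A program that runs forever from `σ` is related to no
`t` and `τ`. -/
inductive Exec : Prog → State → ℕ → State → Prop
  | skip (σ : State) : Exec .skip σ 1 σ
  | set (σ : State) (a : ℕ) (e f : Expr) :
      Exec (.set a e f) σ (e.cost + f.cost + 1) (σ.write a ⌊e.eval σ⌋ (f.eval σ))
  | seq {P Q : Prog} {σ τ υ : State} {s t : ℕ} :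
      Exec P σ s τ → Exec Q τ t υ → Exec (.seq P Q) σ (s + t) υ
  | ite_true {b : Cond} {P Q : Prog} {σ τ : State} {t : ℕ} :
      b.Holds σ → Exec P σ t τ → Exec (.ite b P Q) σ (b.cost + t + 1) τ
  | ite_false {b : Cond} {P Q : Prog} {σ τ : State} {t : ℕ} :
      ¬ b.Holds σ → Exec Q σ t τ → Exec (.ite b P Q) σ (b.cost + t + 1) τ
  | while_true {b : Cond} {P : Prog} {σ τ υ : State} {s t : ℕ} :
      b.Holds σ → Exec P σ s τ → Exec (.while b P) τ t υ →
        Exec (.while b P) σ (b.cost + s + t + 1) υ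
  | while_false {b : Cond} {P : Prog} {σ : State} :
      ¬ b.Holds σ → Exec (.while b P) σ (b.cost + 1) σ

end RealRAM

/-! ## Empty boxes -/

namespace EmptyBox

/-- The open axis-parallel box `∏ i, (l i, h i)`. -/
def openBox {d : ℕ} (l h : Fin d → ℝ) : Set (Fin d → ℝ) :=
  Set.univ.pi fun i => Set.Ioo (l i) (h i)

/-- `l`, `h` are the lower and upper corners of a (nondegenerate, open, axis-parallel) box that is
contained in the closed box `R` with corners `lo`, `hi` and contains none of the points `p j`. -/
def IsEmptyBox {d n : ℕ} (lo hi : Fin d → ℝ) (p : Fin n → Fin d → ℝ) (l h : Fin d → ℝ) : Prop :=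
  (∀ i, l i < h i) ∧ openBox l h ⊆ Set.Icc lo hi ∧ ∀ j, p j ∉ openBox l h

/-- `l`, `h` are the corners of an empty box in `R` whose volume is at least `1 - ε` times the
volume of every empty box in `R`, in particular of one of maximum volume. -/
def IsApproxMaxEmptyBox {d n : ℕ} (ε : ℝ) (lo hi : Fin d → ℝ) (p : Fin n → Fin d → ℝ)
    (l h : Fin d → ℝ) : Prop :=
  IsEmptyBox lo hi p l h ∧
    ∀ l' h' : Fin d → ℝ, IsEmptyBox lo hi p l' h' →
      (1 - ε) * (MeasureTheory.volume (openBox l' h')).toReal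
        ≤ (MeasureTheory.volume (openBox l h)).toReal

/-- The memory content `σ` holds the input: the numbers `d`, `n`, `ε` in cells `0`, `1`, `2` of
array `0`, the corners of `R` in arrays `1` and `2`, and the coordinates of the points, point after
point, in array `3`.  Nothing is assumed about the other cells. -/
def HoldsInput {d n : ℕ} (σ : RealRAM.State) (ε : ℝ) (lo hi : Fin d → ℝ)
    (p : Fin n → Fin d → ℝ) : Prop :=
  σ 0 0 = d ∧ σ 0 1 = n ∧ σ 0 2 = ε ∧
    (∀ i : Fin d, σ 1 (i : ℕ) = lo i) ∧ (∀ i : Fin d, σ 2 (i : ℕ) = hi i) ∧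
    ∀ (j : Fin n) (i : Fin d), σ 3 ((j : ℕ) * d + (i : ℕ) : ℕ) = p j i

/-- The point of `ℝ^d` stored in the cells `0, …, d - 1` of array `a`. -/
def readPoint (d : ℕ) (σ : RealRAM.State) (a : ℕ) : Fin d → ℝ :=
  fun i => σ a (i : ℕ)

end EmptyBox

/-!
The largest empty box is found, up to the factor `1 - ε`, by looking only at the boxes of a family
of grids.  Let `q = 1 - ε / (2 d)` and `m = ⌈2 d / ε⌉`.  A *scale* is a tuple `k` of natural
numbers; its grid has, along axis `i`, spacing `w i * q ^ k i * q / (m + 1)`, where `w i` is the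
width of `R`, and its boxes consist of `m` consecutive cells along each axis.

* Rounding the relative sides of an empty box down to powers of `q`, and its lower corner up to the
  next grid point, gives a grid box inside it (`IsEmptyBox.exists_free`) and costs at most the factor
  `(q * m / (m + 1)) ^ d ≥ 1 - ε` of the volume (`one_sub_le_pow`).
* One of `n + 1` parallel slabs is empty (`exists_slab`), so only scales with
  `(n + 1) * q ^ ∑ i, k i ≥ 1` matter.  There are at most `(e (1 + 2 log (n + 1) / ε)) ^ d` of them
  (`exists_scales`), by Chernoff's trick (`card_le_of_sum_le`).
* At such a scale there are at most `2 (n + 1) (m + 1) ^ d` grid boxes (`prod_counts_le`), and each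
  point lies in at most `m ^ d` of them, all of which can be listed and marked
  (`exists_hit_iff`, `markAll_runs`).  The boxes left unmarked are empty.  So a scale takes
  `O (d n (m + 1) ^ d)` steps (`treatScale_runs`).
* The scales are visited in colexicographic order; the successor of a scale is found by carrying, in
  `O (d)` steps (`advance_runs`, `eq_or_before_of_before_bump`).

The product of these bounds is `O (d n (7 e d log₂ n / ε²) ^ d)`, and the factor `d` is absorbed by
passing from `7` to `8` (`time_bound`).

Programs are verified with triples `Runs P σ T Q` of total correctness that include a bound `T` on
the number of steps, with one rule per construct and a frame property: a program leaves unchanged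
the arrays to which it does not write.
-/

/-! ### Total correctness with a time bound -/

namespace RealRAM

instance : Add Expr := ⟨Expr.add⟩
instance : Sub Expr := ⟨Expr.sub⟩
instance : Mul Expr := ⟨Expr.mul⟩
instance : Div Expr := ⟨Expr.div⟩

/-- A scalar variable: cell `0` of array `a`.  Every scalar has an array of its own, so that
a program leaves a scalar alone as soon as it does not write to the array. -/
def var (a : ℕ) : Expr := .get a (.const 0)

/-- Assignment to a scalar variable. -/
def assign (a : ℕ) (e : Expr) : Prog := .set a (.const 0) e

section Eval

variable (σ : State) (e f : Expr)

@[simp] theorem eval_add : (e + f).eval σ = e.eval σ + f.eval σ := rfl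
@[simp] theorem eval_sub : (e - f).eval σ = e.eval σ - f.eval σ := rfl
@[simp] theorem eval_mul : (e * f).eval σ = e.eval σ * f.eval σ := rfl
@[simp] theorem eval_div : (e / f).eval σ = e.eval σ / f.eval σ := rfl
@[simp] theorem eval_const (z : ℤ) : (Expr.const z).eval σ = z := rfl
@[simp] theorem eval_floor : (Expr.floor e).eval σ = (⌊e.eval σ⌋ : ℝ) := rfl
@[simp] theorem eval_get (a : ℕ) : (Expr.get a e).eval σ = σ a ⌊e.eval σ⌋ := rfl
@[simp] theorem eval_var (a : ℕ) : (var a).eval σ = σ a 0 := by simp [var]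

@[simp] theorem cost_add : (e + f).cost = e.cost + f.cost + 1 := rfl
@[simp] theorem cost_sub : (e - f).cost = e.cost + f.cost + 1 := rfl
@[simp] theorem cost_mul : (e * f).cost = e.cost + f.cost + 1 := rfl
@[simp] theorem cost_div : (e / f).cost = e.cost + f.cost + 1 := rfl
@[simp] theorem cost_const (z : ℤ) : (Expr.const z).cost = 1 := rfl
@[simp] theorem cost_floor : (Expr.floor e).cost = e.cost + 1 := rfl
@[simp] theorem cost_get (a : ℕ) : (Expr.get a e).cost = e.cost + 1 := rfl
@[simp] theorem cost_var (a : ℕ) : (var a).cost = 2 := rfl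

end Eval

section Write

variable (σ : State) {a b : ℕ} (i j : ℤ) (x : ℝ)

theorem write_of_ne (h : b ≠ a) : σ.write a i x b = σ b := by
  simp [State.write, h]

theorem write_same : σ.write a i x a j = if j = i then x else σ a j := by
  simp [State.write, Function.update_apply]

end Write

/-- `P.writes a` tells whether `P` contains an assignment to a cell of array `a`. -/
def Prog.writes : Prog → ℕ → Bool
  | .skip, _ => false
  | .set a _ _, b => a == b
  | .seq P Q, b => P.writes b || Q.writes b
  | .ite _ P Q, b => P.writes b || Q.writes b
  | .while _ P, b => P.writes b

theorem Exec.frame {P : Prog} {σ τ : State} {t a : ℕ} (h : Exec P σ t τ)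
    (ha : P.writes a = false) : τ a = σ a := by
  induction h with
  | skip => rfl
  | set σ b e f =>
    have : a ≠ b := by
      rintro rfl
      simp [Prog.writes] at ha
    exact write_of_ne _ _ _ this
  | seq _ _ ih₁ ih₂ =>
    simp only [Prog.writes, Bool.or_eq_false_iff] at ha
    rw [ih₂ ha.2, ih₁ ha.1]
  | ite_true _ _ ih =>
    simp only [Prog.writes, Bool.or_eq_false_iff] at ha
    exact ih ha.1
  | ite_false _ _ ih =>
    simp only [Prog.writes, Bool.or_eq_false_iff] at ha
    exact ih ha.2
  | while_true _ _ _ ih₁ ih₂ => rw [ih₂ ha, ih₁ ha]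
  | while_false _ => rfl

/-- `Runs P σ T Q`: started in `σ`, the program `P` halts after at most `T` steps in a memory
content that satisfies `Q`. -/
def Runs (P : Prog) (σ : State) (T : ℕ) (Q : State → Prop) : Prop :=
  ∃ t τ, Exec P σ t τ ∧ t ≤ T ∧ Q τ

namespace Runs

variable {P P' : Prog} {σ : State} {s t T : ℕ} {Q R : State → Prop}

theorem le (h : Runs P σ s Q) (hs : s ≤ T) : Runs P σ T Q :=
  let ⟨t, τ, h₁, h₂, h₃⟩ := h
  ⟨t, τ, h₁, h₂.trans hs, h₃⟩

/-- The postcondition may be weakened with the help of the frame property. -/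
theorem imp (h : Runs P σ T R)
    (hR : ∀ τ, R τ → (∀ a, P.writes a = false → τ a = σ a) → Q τ) : Runs P σ T Q :=
  let ⟨t, τ, h₁, h₂, h₃⟩ := h
  ⟨t, τ, h₁, h₂, hR τ h₃ fun _ ha => h₁.frame ha⟩

theorem skip (h : Q σ) : Runs .skip σ 1 Q := ⟨1, σ, .skip σ, le_rfl, h⟩

theorem set {a : ℕ} {e f : Expr} (h : Q (σ.write a ⌊e.eval σ⌋ (f.eval σ))) :
    Runs (.set a e f) σ (e.cost + f.cost + 1) Q :=
  ⟨_, _, .set σ a e f, le_rfl, h⟩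

theorem assign {a : ℕ} {e : Expr} (h : Q (σ.write a 0 (e.eval σ))) :
    Runs (assign a e) σ (e.cost + 2) Q :=
  (set (by simpa using h)).le (by simp; omega)

theorem seq (h : Runs P σ s R)
    (h' : ∀ τ, R τ → (∀ a, P.writes a = false → τ a = σ a) → Runs P' τ t Q) :
    Runs (.seq P P') σ (s + t) Q := by
  obtain ⟨t₁, τ, h₁, h₂, h₃⟩ := h
  obtain ⟨t₂, υ, h₄, h₅, h₆⟩ := h' τ h₃ fun _ ha => h₁.frame ha
  exact ⟨_, υ, h₁.seq h₄, by omega, h₆⟩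

theorem set_seq {a : ℕ} {e f : Expr}
    (h : Runs P (σ.write a ⌊e.eval σ⌋ (f.eval σ)) t Q) :
    Runs (.seq (.set a e f) P) σ (e.cost + f.cost + 1 + t) Q :=
  seq (R := fun τ => τ = σ.write a ⌊e.eval σ⌋ (f.eval σ)) (set rfl) (by rintro τ rfl _; exact h)

theorem assign_seq {a : ℕ} {e : Expr} (h : Runs P (σ.write a 0 (e.eval σ)) t Q) :
    Runs (.seq (RealRAM.assign a e) P) σ (e.cost + 2 + t) Q :=
  seq (R := fun τ => τ = σ.write a 0 (e.eval σ)) (assign rfl) (by rintro τ rfl _; exact h)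

theorem ite {b : Cond} (h : b.Holds σ → Runs P σ s Q) (h' : ¬ b.Holds σ → Runs P' σ t Q) :
    Runs (.ite b P P') σ (b.cost + max s t + 1) Q := by
  by_cases hb : b.Holds σ
  · obtain ⟨t₁, τ, h₁, h₂, h₃⟩ := h hb
    exact ⟨_, τ, .ite_true hb h₁, by omega, h₃⟩
  · obtain ⟨t₁, τ, h₁, h₂, h₃⟩ := h' hb
    exact ⟨_, τ, .ite_false hb h₁, by omega, h₃⟩

/-- The rule for loops: `I r` is the invariant when at most `r` rounds are left. -/
theorem whileLoop {b : Cond} {c : ℕ} (I : ℕ → State → Prop)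
    (step : ∀ r σ, I r σ → b.Holds σ → ∃ r', r = r' + 1 ∧ Runs P σ c (I r')) (r : ℕ) :
    ∀ σ, I r σ → Runs (.while b P) σ (r * (b.cost + c + 1) + b.cost + 1)
      (fun τ => (∃ r', I r' τ) ∧ ¬ b.Holds τ) := by
  induction r with
  | zero =>
    intro σ hI
    by_cases hb : b.Holds σ
    · obtain ⟨r', h, -⟩ := step 0 σ hI hb
      omega
    · exact ⟨_, σ, .while_false hb, by omega, ⟨_, hI⟩, hb⟩
  | succ r ih =>
    intro σ hI
    by_cases hb : b.Holds σ
    · obtain ⟨r', h, t₁, τ, h₁, h₂, h₃⟩ := step _ σ hI hb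
      obtain rfl : r = r' := by omega
      obtain ⟨t₂, υ, h₄, h₅, h₆⟩ := ih τ h₃
      refine ⟨_, υ, .while_true hb h₁ h₄, ?_, h₆⟩
      rw [add_mul]
      omega
    · exact ⟨_, σ, .while_false hb, by omega, ⟨_, hI⟩, hb⟩

end Runs

/-- `for v = 0, 1, …, e - 1 do P`. -/
def forLoop (v : ℕ) (e : Expr) (P : Prog) : Prog :=
  .seq (assign v (.const 0))
    (.while (.lt (var v) e) (.seq P (assign v (var v + .const 1))))

/-- The rule for counting loops.  The frame property of the loop is available in every round, so
the invariant need only speak about arrays to which the loop writes. -/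
theorem Runs.for {v N c : ℕ} {e : Expr} {P : Prog} {σ : State} (I : ℕ → State → Prop)
    (h0 : I 0 (σ.write v 0 0))
    (he : ∀ τ, (∀ a, (forLoop v e P).writes a = false → τ a = σ a) → e.eval τ = N)
    (hv : P.writes v = false)
    (step : ∀ k τ, k < N → I k τ → τ v 0 = k →
      (∀ a, (forLoop v e P).writes a = false → τ a = σ a) →
      Runs P τ c fun υ => I (k + 1) (υ.write v 0 (k + 1))) :
    Runs (forLoop v e P) σ (N * (c + e.cost + 10) + e.cost + 10) (I N) := by
  have hw : ∀ a, (forLoop v e P).writes a = false → v ≠ a ∧ P.writes a = false := by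
    intro a ha
    have := ha
    simp only [forLoop, RealRAM.assign, Prog.writes, Bool.or_eq_false_iff,
      beq_eq_false_iff_ne] at this
    exact ⟨this.1, this.2.1⟩
  let J : ℕ → State → Prop := fun r τ => ∃ k, k + r = N ∧ I k τ ∧ τ v 0 = k ∧
      ∀ a, (forLoop v e P).writes a = false → τ a = σ a
  have hloop := Runs.whileLoop (b := .lt (var v) e) (P := .seq P (RealRAM.assign v (var v + .const 1)))
    (c := c + 6) J (by
      rintro r τ ⟨k, hk, hI, hkv, hfr⟩ hb
      have hlt : k < N := by
        have := hb
        simp only [Cond.Holds, eval_var, hkv, he τ hfr] at this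
        exact_mod_cast this
      refine ⟨r - 1, by omega, ?_⟩
      refine (Runs.seq (step k τ hlt hI hkv hfr) (t := 6) fun υ hυ hfr' => ?_)
      refine (Runs.assign ?_).le (by simp)
      have hυv : υ v 0 = k := by rw [hfr' v hv, hkv]
      refine ⟨k + 1, by omega, ?_, ?_, ?_⟩
      · simpa [hυv] using hυ
      · simp [write_same, hυv]
      · intro a ha
        rw [write_of_ne _ _ _ (hw a ha).1.symm, hfr' a (hw a ha).2, hfr a ha]) N
    (σ.write v 0 0) ⟨0, by simp, h0, by simp [write_same], fun a ha =>
      write_of_ne _ _ _ (hw a ha).1.symm⟩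
  have hall := hloop.imp (Q := I N) ?_
  · exact Runs.le (Runs.assign_seq (by simpa using hall)) (by
      simp only [cost_const, Cond.cost, cost_var]
      have : N * (2 + e.cost + 1 + (c + 6) + 1) = N * (c + e.cost + 10) := by ring
      omega)
  · rintro τ ⟨⟨r, k, hk, hI, hkv, hfr⟩, hb⟩ -
    have hle : N ≤ k := by
      simp only [Cond.Holds, eval_var, hkv, he τ hfr, not_lt] at hb
      exact_mod_cast hb
    obtain rfl : k = N := by omega
    exact hI

end RealRAM

namespace EmptyBox

/-! ### Mixed radix representation -/

/-- The `i`-th digit of `x` in the mixed radix system with bases `N 0, N 1, …`. -/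
def digit (N : ℕ → ℕ) (x i : ℕ) : ℕ := x / (∏ l ∈ Finset.range i, N l) % N i

/-- The number whose first `d` digits, in the mixed radix system with bases `N`, are `c`. -/
def encode (N c : ℕ → ℕ) (d : ℕ) : ℕ := ∑ i ∈ Finset.range d, c i * ∏ l ∈ Finset.range i, N l

variable {N c : ℕ → ℕ} {d i x : ℕ}

theorem digit_lt (h : 0 < N i) : digit N x i < N i := Nat.mod_lt _ h

theorem encode_lt (h : ∀ i < d, c i < N i) : encode N c d < ∏ l ∈ Finset.range d, N l := by
  induction d with
  | zero => simp [encode]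
  | succ d ih =>
    have h₁ := ih fun i hi => h i (by omega)
    have h₂ := h d (by omega)
    rw [encode] at h₁ ⊢
    rw [Finset.sum_range_succ, Finset.prod_range_succ]
    have h₃ := Nat.mul_le_mul_left (∏ l ∈ Finset.range d, N l) (Nat.succ_le_of_lt h₂)
    rw [Nat.mul_succ, mul_comm _ (c d)] at h₃
    omega

theorem digit_encode (h : ∀ i < d, c i < N i) (hi : i < d) : digit N (encode N c d) i = c i := by
  induction d with
  | zero => omega
  | succ d ih =>
    have h₁ : encode N c (d + 1) = encode N c d + c d * ∏ l ∈ Finset.range d, N l := by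
      simp [encode, Finset.sum_range_succ]
    have hlt := encode_lt (N := N) (c := c) (d := d) fun i hi => h i (by omega)
    have hW : 0 < ∏ l ∈ Finset.range d, N l := by omega
    rcases Nat.lt_succ_iff_lt_or_eq.mp hi with hid | rfl
    · rw [← ih (fun i hi => h i (by omega)) hid, h₁]
      obtain ⟨z, hz⟩ : (∏ l ∈ Finset.range (i + 1), N l) ∣ ∏ l ∈ Finset.range d, N l :=
        Finset.prod_dvd_prod_of_subset _ _ _ (Finset.range_mono (by omega))
      rw [Finset.prod_range_succ] at hz
      have hWi : 0 < ∏ l ∈ Finset.range i, N l := by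
        rcases Nat.eq_zero_or_pos (∏ l ∈ Finset.range i, N l) with h0 | h0
        · simp [h0] at hz; omega
        · exact h0
      have h₂ : encode N c d + c d * ∏ l ∈ Finset.range d, N l
          = encode N c d + (∏ l ∈ Finset.range i, N l) * (N i * (c d * z)) := by
        rw [hz]; ring
      rw [digit, digit, h₂, Nat.add_mul_div_left _ _ hWi, Nat.add_mul_mod_self_left]
    · rw [h₁, digit, Nat.add_mul_div_right _ _ hW, Nat.div_eq_of_lt hlt, zero_add,
        Nat.mod_eq_of_lt (h _ hi)]

theorem encode_digit_eq_mod :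
    encode N (digit N x) d = x % ∏ l ∈ Finset.range d, N l := by
  induction d with
  | zero => simp [encode, Nat.mod_one]
  | succ d ih =>
    rw [encode, Finset.sum_range_succ, ← encode, ih, Finset.prod_range_succ, Nat.mod_mul, digit]
    ring

theorem encode_digit (h : x < ∏ l ∈ Finset.range d, N l) : encode N (digit N x) d = x := by
  rw [encode_digit_eq_mod, Nat.mod_eq_of_lt h]

/-- The coordinate `i` of the grid box that is `o` steps (coordinatewise, in base `m`) below the
cell `u`. -/
def cellBelow (m : ℕ) (u : ℕ → ℤ) (o i : ℕ) : ℤ := u i - ((o / m ^ i % m : ℕ) : ℤ)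

/-- The pair of the cell `u` and the offset `o` leads to the grid box number `x`. -/
def Hit (d m : ℕ) (N : ℕ → ℕ) (u : ℕ → ℤ) (o : ℕ) (x : ℤ) : Prop :=
  (∀ i < d, 0 ≤ cellBelow m u o i ∧ cellBelow m u o i < N i) ∧
    ∑ i ∈ Finset.range d, cellBelow m u o i * ∏ l ∈ Finset.range i, (N l : ℤ) = x

/-- The grid boxes that are hit from the cell `u` are those that contain it. -/
theorem exists_hit_iff {m : ℕ} {u : ℕ → ℤ} (hN : ∀ i < d, 0 < N i)
    (hx : x < ∏ l ∈ Finset.range d, N l) :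
    (∃ o < m ^ d, Hit d m N u o x) ↔
      ∀ i < d, (digit N x i : ℤ) ≤ u i ∧ u i < digit N x i + m := by
  constructor
  · rintro ⟨o, ho, h₁, h₂⟩
    have hc : ∀ i < d, ((cellBelow m u o i).toNat : ℤ) = cellBelow m u o i := fun i hi =>
      Int.toNat_of_nonneg (h₁ i hi).1
    have hc' : ∀ i < d, (cellBelow m u o i).toNat < N i := fun i hi => by
      have := hc i hi
      have := h₁ i hi
      omega
    have hx' : encode N (fun i => (cellBelow m u o i).toNat) d = x := by
      have : ((encode N (fun i => (cellBelow m u o i).toNat) d : ℕ) : ℤ) = x := by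
        rw [← h₂, encode]
        push_cast
        refine Finset.sum_congr rfl fun i hi => ?_
        rw [← hc i (Finset.mem_range.mp hi)]
        simp
      exact_mod_cast this
    intro i hi
    have hd := digit_encode hc' hi
    rw [hx'] at hd
    have hm : 0 < m := by
      rcases Nat.eq_zero_or_pos m with rfl | h
      · rw [zero_pow (by omega)] at ho; omega
      · exact h
    have := Nat.mod_lt (o / m ^ i) hm
    have h3 := hc i hi
    rw [← hd] at h3
    rw [cellBelow] at h3
    omega
  · intro h
    set t : ℕ → ℕ := fun i => (u i - digit N x i).toNat with ht
    have ht' : ∀ i < d, ((t i : ℕ) : ℤ) = u i - digit N x i := fun i hi =>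
      Int.toNat_of_nonneg (by have := h i hi; omega)
    have htm : ∀ i < d, t i < (fun _ => m) i := fun i hi => by
      have := h i hi
      have := ht' i hi
      simp only
      omega
    have hlt := encode_lt htm
    have hdig := fun i hi => digit_encode (i := i) htm hi
    simp only [digit, Finset.prod_const, Finset.card_range] at hlt hdig
    have hcell : ∀ i < d, cellBelow m u (encode (fun _ => m) t d) i = digit N x i := by
      intro i hi
      rw [cellBelow, hdig i hi, ht' i hi]
      ring
    refine ⟨encode (fun _ => m) t d, hlt, fun i hi => ?_, ?_⟩
    · have := digit_lt (x := x) (hN i hi)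
      rw [hcell i hi]
      omega
    · have := encode_digit hx
      conv_rhs => rw [← this, encode]
      push_cast
      exact Finset.sum_congr rfl fun i hi => by rw [hcell i (Finset.mem_range.mp hi)]

/-! ### The program -/

/-!
The memory is laid out as follows.  Arrays `0` to `5` hold the input and the output.  The loop
counters `vI`, `vJ`, `vO`, `vX` run over axes, points, offsets and grid boxes.  The scalars `vM`,
`vQ`, `vW` hold `m`, `q` and `m ^ d`; `vP` holds `(n + 1) * q ^ ∑ i, k i` for the current scale `k`,
and `vBest` the value of `vP` for the best box found; `vT` is the number of grid boxes; `vRun` is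
positive as long as scales are left; `vBad` is positive if the box computed by `locate` lies outside
the grid.  The arrays `aF`, `aG`, `aN` hold, for each axis, the relative side `q ^ k i`, the grid
spacing and the number of positions; `aMark` holds the marks of the grid boxes.  The
other scalars are scratch space.
-/

open RealRAM

local infixr:60 " ;; " => Prog.seq
local notation "aLo" => 1
local notation "aHi" => 2
local notation "aPt" => 3
local notation "outL" => 4
local notation "outH" => 5
local notation "vI" => 10
local notation "vJ" => 11
local notation "vO" => 12
local notation "vX" => 13
local notation "vM" => 14
local notation "vQ" => 15
local notation "vW" => 16
local notation "vP" => 17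
local notation "vBest" => 18
local notation "vT" => 19
local notation "vR" => 20
local notation "vIdx" => 21
local notation "vRun" => 22
local notation "vBad" => 23
local notation "vC" => 24
local notation "vS" => 25
local notation "aF" => 30
local notation "aG" => 31
local notation "aN" => 32
local notation "aMark" => 33

/-- The cell of array `a` that belongs to the current axis. -/
def axis (a : ℕ) : Expr := .get a (var vI)

@[simp] theorem eval_axis (σ : State) (a : ℕ) : (axis a).eval σ = σ a ⌊σ vI 0⌋ := by simp [axis]

@[simp] theorem cost_axis (a : ℕ) : (axis a).cost = 3 := rfl

/-- Computes the spacings, the numbers of positions and the number of boxes of a grid. -/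
def prepare : Prog :=
  assign vT (.const 1) ;; forLoop vI (var 0) (
    .set aG (var vI) ((axis aHi - axis aLo) * axis aF * var vQ / (var vM + .const 1)) ;;
    .set aN (var vI) (.floor ((var vM + .const 1) / (axis aF * var vQ)) - var vM + .const 1) ;;
    assign vT (var vT * axis aN))

/-- Removes all marks. -/
def clear : Prog := forLoop vX (var vT) (.set aMark (var vX) (.const 0))

/-- Computes the number of the grid box whose position is obtained from the cell of point `vJ` by
subtracting the digits of `vO` in base `m`.  In this way each box containing the point arises. -/
def locate : Prog :=
  assign vR (var vO) ;; assign vIdx (.const 0) ;; assign vS (.const 1) ;; assign vBad (.const 0) ;;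
  forLoop vI (var 0) (
    assign vC (.floor ((.get aPt (var vJ * var 0 + var vI) - axis aLo) / axis aG)
      - (var vR - var vM * .floor (var vR / var vM))) ;;
    assign vR (.floor (var vR / var vM)) ;;
    assign vIdx (var vIdx + var vC * var vS) ;;
    assign vS (var vS * axis aN) ;;
    .ite (.and (.le (.const 0) (var vC)) (.lt (var vC) (axis aN))) .skip (assign vBad (.const 1)))

/-- Marks all grid boxes that contain a point. -/
def markAll : Prog :=
  forLoop vJ (.get 0 (.const 1)) (forLoop vO (var vW)
    (locate ;; .ite (.lt (.const 0) (var vBad)) .skip (.set aMark (var vIdx) (.const 1))))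

/-- Outputs the grid box number `vX`, whose position consists of the mixed radix digits of `vX`. -/
def record : Prog :=
  assign vBest (var vP) ;; assign vR (var vX) ;; forLoop vI (var 0) (
    assign vC (var vR - axis aN * .floor (var vR / axis aN)) ;;
    assign vR (.floor (var vR / axis aN)) ;;
    .set outL (var vI) (axis aLo + axis aG * var vC) ;;
    .set outH (var vI) (axis aLo + axis aG * (var vC + var vM)))

/-- Looks for an unmarked grid box. -/
def scan : Prog :=
  forLoop vX (var vT)
    (.ite (.and (.lt (.get aMark (var vX)) (.const 1)) (.lt (var vBest) (var vP))) record .skip)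

/-- Treats one scale: outputs one of its free boxes, if there is one and it beats the best so far. -/
def treatScale : Prog := prepare ;; clear ;; markAll ;; scan

/-- Passes to the next scale: coordinates that cannot be increased without leaving the admissible
tuples are reset to `0`, up to the first one that can. -/
def advance : Prog :=
  assign vI (.const 0) ;;
  .while (.and (.lt (var vI) (var 0)) (.lt (var vP * var vQ) (.const 1)))
    (assign vP (var vP / axis aF) ;; .set aF (var vI) (.const 1) ;;
      assign vI (var vI + .const 1)) ;;
  .ite (.lt (var vI) (var 0))
    (.set aF (var vI) (axis aF * var vQ) ;; assign vP (var vP * var vQ))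
    (assign vRun (.const 0))

/-- Sets the parameters and starts with the coarsest scale. -/
def setUp : Prog :=
  assign vM (.const 0 - .floor (.const 0 - .const 2 * var 0 / .get 0 (.const 2))) ;;
  assign vQ (.const 1 - .get 0 (.const 2) / (.const 2 * var 0)) ;;
  assign vP (.get 0 (.const 1) + .const 1) ;; assign vBest (.const 0) ;;
  assign vRun (.const 1) ;; assign vW (.const 1) ;;
  forLoop vI (var 0) (assign vW (var vW * var vM) ;; .set aF (var vI) (.const 1))

/-- The whole program. -/
def largestEmptyBox : Prog :=
  setUp ;; .while (.lt (.const 0) (var vRun)) (treatScale ;; advance)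

/-! ### Treating one scale -/

theorem floor_cast_div (a b : ℕ) : ⌊(a : ℝ) / b⌋ = ((a / b : ℕ) : ℤ) := by
  rw [← Int.natCast_floor_eq_floor (by positivity), Nat.floor_div_natCast, Nat.floor_natCast]

/-- The number of positions along an axis of a grid box with relative side `f * q * m / (m + 1)`,
where the grid spacing is one `m`-th of the side. -/
noncomputable def gridN (m : ℕ) (q f : ℝ) : ℕ := (⌊((m : ℝ) + 1) / (f * q)⌋ - m + 1).toNat

theorem le_floor_div {m : ℕ} {q f : ℝ} (hq : 0 < q) (hq' : q ≤ 1) (hf : 0 < f) (hf' : f ≤ 1) :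
    (m : ℤ) ≤ ⌊((m : ℝ) + 1) / (f * q)⌋ := by
  rw [Int.le_floor, le_div_iff₀ (by positivity)]
  have : f * q ≤ 1 := mul_le_one₀ hf' hq.le hq'
  have hm : (0 : ℝ) ≤ m := by positivity
  push_cast
  nlinarith

theorem gridN_cast {m : ℕ} {q f : ℝ} (hq : 0 < q) (hq' : q ≤ 1) (hf : 0 < f) (hf' : f ≤ 1) :
    ((gridN m q f : ℕ) : ℤ) = ⌊((m : ℝ) + 1) / (f * q)⌋ - m + 1 := by
  have := le_floor_div (m := m) hq hq' hf hf'
  exact Int.toNat_of_nonneg (by omega)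

theorem gridN_pos {m : ℕ} {q f : ℝ} (hq : 0 < q) (hq' : q ≤ 1) (hf : 0 < f) (hf' : f ≤ 1) :
    0 < gridN m q f := by
  have h := gridN_cast (m := m) hq hq' hf hf'
  have := le_floor_div (m := m) hq hq' hf hf'
  omega

theorem prepare_runs {d m : ℕ} {q : ℝ} {f : ℕ → ℝ} {σ : State} (h0 : σ 0 0 = d) (hM : σ vM 0 = m)
    (hQ : σ vQ 0 = q) (hF : ∀ i < d, σ aF (i : ℕ) = f i) (hq : 0 < q) (hq' : q ≤ 1)
    (hf : ∀ i < d, 0 < f i ∧ f i ≤ 1) :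
    Runs prepare σ (d * 70 + 20) fun τ =>
      (∀ i < d, τ aG (i : ℕ) = (σ aHi i - σ aLo i) * f i * q / (m + 1)) ∧
      (∀ i < d, τ aN (i : ℕ) = gridN m q (f i)) ∧
      τ vT 0 = (∏ i ∈ Finset.range d, gridN m q (f i) : ℕ) := by
  refine Runs.le (Runs.assign_seq (Runs.for (N := d) (c := 56) (fun k τ =>
      (∀ i < k, τ aG (i : ℕ) = (σ aHi i - σ aLo i) * f i * q / (m + 1)) ∧
      (∀ i < k, τ aN (i : ℕ) = gridN m q (f i)) ∧
      τ vT 0 = (∏ i ∈ Finset.range k, gridN m q (f i) : ℕ)) ?_ ?_ rfl ?_)) ?_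
  · simp [write_same, write_of_ne]
  · intro τ hτ
    simp [hτ 0 rfl, write_of_ne, h0]
  · rintro k τ hk ⟨h1, h2, h3⟩ hI hτ
    have e0 : τ 0 = σ 0 := by simpa [write_of_ne] using hτ 0 rfl
    have e1 : τ aLo = σ aLo := by simpa [write_of_ne] using hτ aLo rfl
    have e2 : τ aHi = σ aHi := by simpa [write_of_ne] using hτ aHi rfl
    have eM : τ vM = σ vM := by simpa [write_of_ne] using hτ vM rfl
    have eQ : τ vQ = σ vQ := by simpa [write_of_ne] using hτ vQ rfl
    have eF : τ aF = σ aF := by simpa [write_of_ne] using hτ aF rfl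
    have hN : ((gridN m q (f k) : ℕ) : ℝ) = ⌊((m : ℝ) + 1) / (f k * q)⌋ - m + 1 := by
      have := gridN_cast (m := m) hq hq' (hf k hk).1 (hf k hk).2
      exact_mod_cast this
    refine Runs.le (Runs.set_seq (Runs.set_seq (Runs.assign ?_))) ?_
    · simp [write_same, write_of_ne, hI, e1, e2, eM, eQ, eF, hM, hQ, hF k hk, h3, ← hN,
        Finset.prod_range_succ]
      constructor <;> intro i hi
      · split_ifs with h
        · rw [h]
        · exact h1 i (by omega)
      · split_ifs with h
        · rw [h]
        · exact h2 i (by omega)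
    · simp
  · simp
    omega

theorem clear_runs {T : ℕ} {σ : State} (hT : σ vT 0 = T) :
    Runs clear σ (T * 20 + 20) fun τ => ∀ x < T, τ aMark (x : ℕ) = 0 := by
  refine Runs.le (Runs.for (N := T) (c := 4) (fun k τ => ∀ x < k, τ aMark (x : ℕ) = 0)
    ?_ ?_ rfl ?_) ?_
  · simp
  · intro τ hτ
    simp [hτ vT rfl, hT]
  · rintro k τ hk h hI hτ
    refine Runs.le (Runs.set ?_) ?_
    · simp [write_same, write_of_ne, hI]
      intro x hx
      by_cases h' : x = k
      · simp [h']
      · intro _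
        exact h x (by omega)
    · simp
  · simp
    omega

theorem locate_runs {d m j o : ℕ} {N : ℕ → ℕ} {u : ℕ → ℤ} {σ : State} (h0 : σ 0 0 = d)
    (hM : σ vM 0 = m) (hO : σ vO 0 = o) (hJ : σ vJ 0 = j) (hN : ∀ i < d, σ aN (i : ℕ) = N i)
    (hu : ∀ i < d, ⌊(σ aPt (j * d + i : ℕ) - σ aLo (i : ℕ)) / σ aG (i : ℕ)⌋ = u i) :
    Runs locate σ (d * 100 + 50) fun τ =>
      (0 < τ vBad 0 ↔ ¬ ∀ i < d, 0 ≤ cellBelow m u o i ∧ cellBelow m u o i < N i) ∧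
      τ vIdx 0 = (∑ i ∈ Finset.range d, cellBelow m u o i *
        ∏ l ∈ Finset.range i, (N l : ℤ) : ℤ) := by
  refine Runs.le (Runs.imp (Runs.assign_seq (Runs.assign_seq (Runs.assign_seq (Runs.assign_seq
    (Runs.for (N := d) (c := 75) (fun k τ =>
      (0 < τ vBad 0 ↔ ¬ ∀ i < k, 0 ≤ cellBelow m u o i ∧ cellBelow m u o i < N i) ∧
      τ vIdx 0 = (∑ i ∈ Finset.range k, cellBelow m u o i *
        ∏ l ∈ Finset.range i, (N l : ℤ) : ℤ) ∧
      τ vR 0 = (o / m ^ k : ℕ) ∧ τ vS 0 = (∏ l ∈ Finset.range k, (N l : ℤ) : ℤ))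
      ?_ ?_ rfl ?_))))) ?_) ?_
  · simp [write_same, write_of_ne, hO]
  · intro τ hτ
    simp [hτ 0 rfl, write_of_ne, h0]
  · rintro k τ hk ⟨h1, h2, h3, h4⟩ hI hτ
    have e0 : τ 0 = σ 0 := by simpa [write_of_ne] using hτ 0 rfl
    have e1 : τ aLo = σ aLo := by simpa [write_of_ne] using hτ aLo rfl
    have e3 : τ aPt = σ aPt := by simpa [write_of_ne] using hτ aPt rfl
    have eM : τ vM = σ vM := by simpa [write_of_ne] using hτ vM rfl
    have eJ : τ vJ = σ vJ := by simpa [write_of_ne] using hτ vJ rfl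
    have eG : τ aG = σ aG := by simpa [write_of_ne] using hτ aG rfl
    have eN : τ aN = σ aN := by simpa [write_of_ne] using hτ aN rfl
    obtain ⟨A, hA⟩ : ∃ A : ℤ, A = (j * d + k : ℕ) := ⟨_, rfl⟩
    have hadr : ⌊(j : ℝ) * d + k⌋ = A := by
      rw [hA, ← Int.floor_natCast (R := ℝ)]
      push_cast
      rfl
    have hu' := hu k hk
    rw [← hA] at hu'
    obtain ⟨W, hW⟩ : ∃ W, W = o / m ^ k := ⟨_, rfl⟩
    obtain ⟨V, hV⟩ : ∃ V, V = W / m := ⟨_, rfl⟩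
    have hdiv : V = o / m ^ (k + 1) := by
      rw [hV, hW, Nat.div_div_eq_div_mul, pow_succ]
    have hfl : ⌊(W : ℝ) / m⌋ = (V : ℤ) := by rw [floor_cast_div, hV]
    rw [← hW] at h3
    obtain ⟨D, hD⟩ : ∃ D, D = cellBelow m u o k := ⟨_, rfl⟩
    have hval : (u k : ℝ) - (W - m * V) = D := by
      have := Nat.div_add_mod W m
      have h' : (W : ℝ) = m * V + (W % m : ℕ) := by
        rw [hV]
        exact_mod_cast this.symm
      rw [hD, cellBelow, ← hW]
      simp only [Int.cast_sub, Int.cast_natCast]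
      linarith
    have hall : (∀ i < k + 1, 0 ≤ cellBelow m u o i ∧ cellBelow m u o i < N i) ↔
        (∀ i < k, 0 ≤ cellBelow m u o i ∧ cellBelow m u o i < N i) ∧ 0 ≤ D ∧ D < N k := by
      rw [hD]
      exact Nat.forall_lt_succ_right
    have hsum : τ vIdx 0 + D * τ vS 0 = (∑ i ∈ Finset.range (k + 1), cellBelow m u o i *
        ∏ l ∈ Finset.range i, (N l : ℤ) : ℤ) := by
      rw [Finset.sum_range_succ, h2, h4, ← hD]
      push_cast
      rfl
    have hprod : τ vS 0 * N k = (∏ l ∈ Finset.range (k + 1), (N l : ℤ) : ℤ) := by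
      rw [Finset.prod_range_succ, h4]
      push_cast
      rfl
    rw [← hdiv, ← hsum, ← hprod, hall]
    refine Runs.le (Runs.assign_seq (Runs.assign_seq (Runs.assign_seq (Runs.assign_seq
      (Runs.ite (fun hb => Runs.skip ?_) (fun hb => Runs.assign ?_)))))) ?_
    · simp only [write_same, write_of_ne, ne_eq, Nat.reduceEqDiff, not_false_eq_true, if_true,
        eval_add, eval_sub, eval_mul, eval_div, eval_floor, eval_get, eval_var,
        eval_axis, hI, e0, e1, e3, eM, eJ, eG, eN, h0, hM, hJ, hadr, h3, hfl, hu', hN k hk,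
        Int.floor_natCast, Int.cast_natCast, Cond.Holds, hval, eval_const, Int.cast_zero] at hb ⊢
      have hb' : 0 ≤ D ∧ D < N k := by exact_mod_cast hb
      simp [hb', h1]
    · simp only [write_same, write_of_ne, ne_eq, Nat.reduceEqDiff, not_false_eq_true, if_true,
        eval_add, eval_sub, eval_mul, eval_div, eval_floor, eval_get, eval_var,
        eval_axis, hI, e0, e1, e3, eM, eJ, eG, eN, h0, hM, hJ, hadr, h3, hfl, hu', hN k hk,
        Int.floor_natCast, Int.cast_natCast, Cond.Holds, hval, eval_const, Int.cast_zero] at hb ⊢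
      have hb' : ¬ (0 ≤ D ∧ D < N k) := by exact_mod_cast hb
      simp [hb']
    · simp [Cond.cost]
  · rintro τ ⟨h1, h2, -⟩ -
    exact ⟨h1, h2⟩
  · simp
    omega

/-- Along each axis, the cell of point `j` and the extent of box number `x` overlap. -/
def Covers (d m : ℕ) (N : ℕ → ℕ) (u : ℕ → ℤ) (x : ℕ) : Prop :=
  ∀ i < d, (digit N x i : ℤ) ≤ u i ∧ u i < digit N x i + m

theorem markAll_runs {d n m : ℕ} {N : ℕ → ℕ} {u : ℕ → ℕ → ℤ} {σ : State} (h0 : σ 0 0 = d)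
    (hn : σ 0 1 = n) (hM : σ vM 0 = m) (hW : σ vW 0 = (m ^ d : ℕ))
    (hN : ∀ i < d, σ aN (i : ℕ) = N i) (hpos : ∀ i < d, 0 < N i)
    (hu : ∀ j < n, ∀ i < d,
      ⌊(σ aPt (j * d + i : ℕ) - σ aLo (i : ℕ)) / σ aG (i : ℕ)⌋ = u j i)
    (hmark : ∀ x < ∏ i ∈ Finset.range d, N i, σ aMark (x : ℕ) = 0) :
    Runs markAll σ (n * (m ^ d * (d * 100 + 80) + 40) + 20) fun τ =>
      ∀ x < ∏ i ∈ Finset.range d, N i,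
        (τ aMark (x : ℕ) < 1 ↔ ∀ j < n, ¬ Covers d m N (u j) x) := by
  -- The marks after `o` offsets of point `j`: the boxes hit so far.
  let I : ℕ → ℕ → State → Prop := fun j o τ => ∀ x < ∏ i ∈ Finset.range d, N i,
    (τ aMark (x : ℕ) < 1 ↔ (∀ j' < j, ∀ o' < m ^ d, ¬ Hit d m N (u j') o' x) ∧
      ∀ o' < o, ¬ Hit d m N (u j) o' x)
  refine Runs.le (Runs.imp (Runs.for (N := n) (c := m ^ d * (d * 100 + 75) + 20)
    (fun j τ => I j 0 τ) ?_ ?_ rfl ?_) ?_) ?_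
  · intro x hx
    simp [write_of_ne, hmark x hx]
  · intro τ hτ
    simpa [hτ 0 rfl] using hn
  · rintro j τ hj hI hvJ hτ
    refine Runs.le (Runs.imp (Runs.for (N := m ^ d) (c := d * 100 + 62)
      (fun o τ => I j o τ) ?_ ?_ rfl ?_) ?_) ?_
    · intro x hx
      simpa [write_of_ne] using hI x hx
    · intro υ hυ
      simp [hυ vW rfl, hτ vW rfl, hW]
    · rintro o υ ho hI' hvO hυ
      have e : ∀ a, (forLoop vO (var vW)
          (locate ;; .ite (.lt (.const 0) (var vBad)) .skip
            (.set aMark (var vIdx) (.const 1)))).writes a = false →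
          (vJ ≠ a) → υ a = σ a := by
        intro a ha haJ
        rw [hυ a ha, hτ a (by
          simp only [forLoop, RealRAM.assign, Prog.writes, Bool.or_eq_false_iff,
            beq_eq_false_iff_ne] at ha ⊢
          tauto)]
      have eJ : υ vJ = τ vJ := hυ vJ rfl
      refine Runs.le (Runs.seq (locate_runs (d := d) (m := m) (j := j) (o := o) (N := N)
        (u := u j) ?_ ?_ hvO ?_ ?_ ?_) (t := 12) ?_) ?_
      · rw [e 0 rfl (by decide), h0]
      · rw [e vM rfl (by decide), hM]
      · rw [eJ, hvJ]
      · rw [e aN rfl (by decide)]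
        exact hN
      · rw [e aPt rfl (by decide), e aLo rfl (by decide), e aG rfl (by decide)]
        exact hu j hj
      · rintro ω ⟨hbad, hidx⟩ hω
        have hmk : ω aMark = υ aMark := hω _ rfl
        have hIs : ∀ x < ∏ i ∈ Finset.range d, N i, (ω aMark (x : ℕ) < 1 ∧ ¬ Hit d m N (u j) o x ↔
            (∀ j' < j, ∀ o' < m ^ d, ¬ Hit d m N (u j') o' x) ∧
              ∀ o' < o + 1, ¬ Hit d m N (u j) o' x) := by
          intro x hx
          rw [hmk, hI' x hx, Nat.forall_lt_succ_right, and_assoc]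
        refine Runs.le (Runs.ite (fun hb => Runs.skip ?_) (fun hb => Runs.set ?_)) ?_
        · intro x hx
          rw [write_of_ne _ _ _ (by decide), ← hIs x hx]
          simp only [Cond.Holds, eval_const, Int.cast_zero, eval_var] at hb
          have : ¬ Hit d m N (u j) o x := fun h => (hbad.mp hb) h.1
          simp [this]
        · intro x hx
          rw [write_of_ne _ _ _ (by decide), ← hIs x hx, write_same]
          simp only [Cond.Holds, eval_const, Int.cast_zero, eval_var, hbad, not_not] at hb
          simp only [eval_var, eval_const, hidx, Int.floor_intCast]
          split_ifs with h
          · have : Hit d m N (u j) o x := ⟨hb, h.symm⟩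
            simp [this]
          · have : ¬ Hit d m N (u j) o x := fun h' => h h'.2.symm
            simp [this]
        · simp [Cond.cost]
      · omega
    · intro υ hυ hfr x hx
      rw [write_of_ne _ _ _ (by decide), hυ x hx, Nat.forall_lt_succ_right]
      simp
    · simp
      ring_nf
      omega
  · intro τ hτ _ x hx
    rw [hτ x hx]
    simp only [Nat.not_lt_zero, false_imp_iff, implies_true, and_true]
    refine forall₂_congr fun j _ => ?_
    rw [Covers, ← exists_hit_iff hpos hx]
    push Not
    rfl
  · simp
    ring_nf
    omega

theorem record_runs {d m x : ℕ} {N : ℕ → ℕ} {σ : State} (h0 : σ 0 0 = d) (hM : σ vM 0 = m)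
    (hX : σ vX 0 = x) (hN : ∀ i < d, σ aN (i : ℕ) = N i) :
    Runs record σ (d * 100 + 50) fun τ => τ vBest 0 = σ vP 0 ∧
      ∀ i < d, τ outL (i : ℕ) = σ aLo i + σ aG i * digit N x i ∧
        τ outH (i : ℕ) = σ aLo i + σ aG i * (digit N x i + m) := by
  refine Runs.le (Runs.imp (Runs.assign_seq (Runs.assign_seq
    (Runs.for (N := d) (c := 75) (fun k τ => τ vBest 0 = σ vP 0 ∧
      (∀ i < k, τ outL (i : ℕ) = σ aLo i + σ aG i * digit N x i ∧
        τ outH (i : ℕ) = σ aLo i + σ aG i * (digit N x i + m)) ∧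
      τ vR 0 = (x / ∏ l ∈ Finset.range k, N l : ℕ))
      ?_ ?_ rfl ?_))) ?_) ?_
  · simp [write_same, write_of_ne, hX]
  · intro τ hτ
    simp [hτ 0 rfl, write_of_ne, h0]
  · rintro k τ hk ⟨h1, h2, h3⟩ hI hτ
    have e1 : τ aLo = σ aLo := by simpa [write_of_ne] using hτ aLo rfl
    have eM : τ vM = σ vM := by simpa [write_of_ne] using hτ vM rfl
    have eG : τ aG = σ aG := by simpa [write_of_ne] using hτ aG rfl
    have eN : τ aN = σ aN := by simpa [write_of_ne] using hτ aN rfl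
    obtain ⟨W, hW⟩ : ∃ W, W = x / ∏ l ∈ Finset.range k, N l := ⟨_, rfl⟩
    obtain ⟨V, hV⟩ : ∃ V, V = W / N k := ⟨_, rfl⟩
    have hdiv : V = x / ∏ l ∈ Finset.range (k + 1), N l := by
      rw [hV, hW, Nat.div_div_eq_div_mul, Finset.prod_range_succ]
    have hfl : ⌊(W : ℝ) / N k⌋ = (V : ℤ) := by rw [floor_cast_div, hV]
    rw [← hW] at h3
    obtain ⟨D, hD⟩ : ∃ D, D = digit N x k := ⟨_, rfl⟩
    have hval : (W : ℝ) - N k * V = D := by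
      have h' : (W : ℝ) = N k * V + (W % N k : ℕ) := by
        rw [hV]
        exact_mod_cast (Nat.div_add_mod W (N k)).symm
      rw [hD, digit, ← hW]
      linarith
    rw [← hdiv]
    refine Runs.le (Runs.assign_seq (Runs.assign_seq (Runs.set_seq (Runs.set ?_)))) ?_
    · simp only [write_same, write_of_ne, ne_eq, Nat.reduceEqDiff, not_false_eq_true, if_true,
        eval_add, eval_sub, eval_mul, eval_div, eval_floor, eval_var,
        eval_axis, hI, e1, eM, eG, eN, hM, h3, hfl, hN k hk,
        Int.floor_natCast, Int.cast_natCast, hval, h1, true_and, and_true]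
      intro i hi
      by_cases hik : i = k
      · simp [hik, hD]
      · simpa [hik] using h2 i (by omega)
    · simp
  · rintro τ ⟨h1, h2, -⟩ -
    exact ⟨h1, h2⟩
  · simp
    omega

theorem scan_runs {d m T : ℕ} {N : ℕ → ℕ} {σ : State} (h0 : σ 0 0 = d) (hM : σ vM 0 = m)
    (hT : σ vT 0 = T) (hN : ∀ i < d, σ aN (i : ℕ) = N i) :
    Runs scan σ (T * (d * 100 + 80) + 20) fun τ =>
      (∃ x < T, σ aMark (x : ℕ) < 1 ∧ σ vBest 0 < σ vP 0 ∧ τ vBest 0 = σ vP 0 ∧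
        ∀ i < d, τ outL (i : ℕ) = σ aLo i + σ aG i * digit N x i ∧
          τ outH (i : ℕ) = σ aLo i + σ aG i * (digit N x i + m)) ∨
      τ vBest = σ vBest ∧ τ outL = σ outL ∧ τ outH = σ outH ∧
        (σ vBest 0 < σ vP 0 → ∀ x < T, ¬ σ aMark (x : ℕ) < 1) := by
  refine Runs.le (Runs.for (N := T) (c := d * 100 + 62) (fun k τ =>
      (∃ x < T, σ aMark (x : ℕ) < 1 ∧ σ vBest 0 < σ vP 0 ∧ τ vBest 0 = σ vP 0 ∧
        ∀ i < d, τ outL (i : ℕ) = σ aLo i + σ aG i * digit N x i ∧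
          τ outH (i : ℕ) = σ aLo i + σ aG i * (digit N x i + m)) ∨
      τ vBest = σ vBest ∧ τ outL = σ outL ∧ τ outH = σ outH ∧
        (σ vBest 0 < σ vP 0 → ∀ x < k, ¬ σ aMark (x : ℕ) < 1)) ?_ ?_ rfl ?_) ?_
  · simp [write_of_ne]
  · intro τ hτ
    simp [hτ vT rfl, hT]
  · rintro k τ hk hI hvX hτ
    have e0 := hτ 0 rfl
    have e1 := hτ aLo rfl
    have eM := hτ vM rfl
    have eP := hτ vP rfl
    have eG := hτ aG rfl
    have eN := hτ aN rfl
    have eK := hτ aMark rfl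
    refine Runs.le (Runs.ite (fun hb => Runs.imp (record_runs (d := d) (m := m) (x := k) (N := N)
      (by rw [e0, h0]) (by rw [eM, hM]) hvX (by rw [eN]; exact hN)) ?_)
      (fun hb => Runs.skip ?_)) ?_
    · rintro υ ⟨h1, h2⟩ -
      simp only [Cond.Holds, eval_get, eval_var, hvX, Int.floor_natCast, eval_const, Int.cast_one,
        eK, eP] at hb
      rw [e1, eG] at h2
      rw [eP] at h1
      rcases hI with ⟨-, -, -, -, hI, -⟩ | ⟨hI, -⟩
      · rw [hI] at hb
        exact absurd hb.2 (lt_irrefl _)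
      · left
        rw [hI] at hb
        refine ⟨k, hk, hb.1, hb.2, ?_⟩
        simpa only [write_of_ne, ne_eq, Nat.reduceEqDiff, not_false_eq_true] using ⟨h1, h2⟩
    · simp only [write_of_ne, ne_eq, Nat.reduceEqDiff, not_false_eq_true]
      refine hI.imp id fun ⟨h1, h2, h3, h4⟩ => ⟨h1, h2, h3, fun hlt x hx => ?_⟩
      rcases Nat.lt_succ_iff_lt_or_eq.mp hx with hx | rfl
      · exact h4 hlt x hx
      · simp only [Cond.Holds, eval_get, eval_var, hvX, Int.floor_natCast, eval_const,
          Int.cast_one, eK, eP, h1] at hb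
        exact fun h => hb ⟨h, hlt⟩
    · simp [Cond.cost]
      omega
  · simp
    ring_nf
    omega

theorem treatScale_runs {d n m : ℕ} {q : ℝ} {f : ℕ → ℝ} {σ : State} (h0 : σ 0 0 = d)
    (hn : σ 0 1 = n) (hM : σ vM 0 = m) (hW : σ vW 0 = (m ^ d : ℕ))
    (hQ : σ vQ 0 = q) (hF : ∀ i < d, σ aF (i : ℕ) = f i) (hq : 0 < q) (hq' : q ≤ 1)
    (hf : ∀ i < d, 0 < f i ∧ f i ≤ 1) {N : ℕ → ℕ} (hN : ∀ i, N i = gridN m q (f i))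
    {g : ℕ → ℝ} (hg : ∀ i : ℕ, g i = (σ aHi i - σ aLo i) * f i * q / (m + 1))
    {u : ℕ → ℕ → ℤ}
    (hu : ∀ j i : ℕ, u j i = ⌊(σ aPt (j * d + i : ℕ) - σ aLo (i : ℕ)) / g i⌋) :
    Runs treatScale σ ((d * 100 + 100) * (∏ i ∈ Finset.range d, N i + n * m ^ d + n + 1)) fun τ =>
      (∃ x < ∏ i ∈ Finset.range d, N i, (∀ j < n, ¬ Covers d m N (u j) x) ∧
        σ vBest 0 < σ vP 0 ∧ τ vBest 0 = σ vP 0 ∧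
        ∀ i < d, τ outL (i : ℕ) = σ aLo i + g i * digit N x i ∧
          τ outH (i : ℕ) = σ aLo i + g i * (digit N x i + m)) ∨
      τ vBest = σ vBest ∧ τ outL = σ outL ∧ τ outH = σ outH ∧
        (σ vBest 0 < σ vP 0 →
          ∀ x < ∏ i ∈ Finset.range d, N i, ¬ ∀ j < n, ¬ Covers d m N (u j) x) := by
  refine Runs.le (Runs.seq (prepare_runs h0 hM hQ hF hq hq' hf)
    (t := (∏ i ∈ Finset.range d, N i) * 20 + 20 + (n * (m ^ d * (d * 100 + 80) + 40) + 20 +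
      ((∏ i ∈ Finset.range d, N i) * (d * 100 + 80) + 20))) ?_) ?_
  · rintro τ₁ ⟨hG₁, hN₁, hT₁⟩ fr₁
    simp only [← hN] at hN₁ hT₁
    simp only [← hg] at hG₁
    refine Runs.seq (clear_runs hT₁) fun τ₂ hK₂ fr₂ => ?_
    have hN₂ : ∀ i < d, τ₂ aN (i : ℕ) = N i := by rw [fr₂ aN rfl]; exact hN₁
    have hG₂ : ∀ i < d, τ₂ aG (i : ℕ) = g i := by rw [fr₂ aG rfl]; exact hG₁
    refine Runs.seq (markAll_runs (d := d) (n := n) (m := m) (N := N) (u := u) ?_ ?_ ?_ ?_ hN₂ ?_ ?_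
      hK₂) fun τ₃ hK₃ fr₃ => ?_
    · rw [fr₂ 0 rfl, fr₁ 0 rfl, h0]
    · rw [fr₂ 0 rfl, fr₁ 0 rfl, hn]
    · rw [fr₂ vM rfl, fr₁ vM rfl, hM]
    · rw [fr₂ vW rfl, fr₁ vW rfl, hW]
    · intro i hi
      rw [hN]
      exact gridN_pos hq hq' (hf i hi).1 (hf i hi).2
    · intro j _ i hi
      rw [hu, hG₂ i hi, fr₂ aPt rfl, fr₁ aPt rfl, fr₂ aLo rfl, fr₁ aLo rfl]
    · have eB : τ₃ vBest = σ vBest := by rw [fr₃ _ rfl, fr₂ _ rfl, fr₁ _ rfl]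
      have eP : τ₃ vP = σ vP := by rw [fr₃ _ rfl, fr₂ _ rfl, fr₁ _ rfl]
      have eL : τ₃ aLo = σ aLo := by rw [fr₃ _ rfl, fr₂ _ rfl, fr₁ _ rfl]
      have eo : τ₃ outL = σ outL := by rw [fr₃ _ rfl, fr₂ _ rfl, fr₁ _ rfl]
      have eo' : τ₃ outH = σ outH := by rw [fr₃ _ rfl, fr₂ _ rfl, fr₁ _ rfl]
      have hG₃ : ∀ i < d, τ₃ aG (i : ℕ) = g i := by rw [fr₃ aG rfl]; exact hG₂
      refine Runs.imp (scan_runs (d := d) (m := m) (T := ∏ i ∈ Finset.range d, N i) (N := N)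
        ?_ ?_ ?_ ?_) ?_
      · rw [fr₃ 0 rfl, fr₂ 0 rfl, fr₁ 0 rfl, h0]
      · rw [fr₃ vM rfl, fr₂ vM rfl, fr₁ vM rfl, hM]
      · rw [fr₃ vT rfl, fr₂ vT rfl, hT₁]
      · rw [fr₃ aN rfl]
        exact hN₂
      · intro τ hτ _
        rw [eB, eP, eL, eo, eo'] at hτ
        refine hτ.imp ?_ ?_
        · rintro ⟨x, hx, h1, h2, h3, h4⟩
          refine ⟨x, hx, (hK₃ x hx).mp h1, h2, h3, fun i hi => ?_⟩
          rw [← hG₃ i hi]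
          exact h4 i hi
        · rintro ⟨h1, h2, h3, h4⟩
          exact ⟨h1, h2, h3, fun hlt x hx => by rw [← hK₃ x hx]; exact h4 hlt x hx⟩
  · have : ((d * 100 + 100) * (∏ i ∈ Finset.range d, N i + n * m ^ d + n + 1))
      = (d * 100 + 100) * (∏ i ∈ Finset.range d, N i) + (d * 100 + 100) * (n * m ^ d)
        + (100 * n + 100 * d * n) + (d * 100 + 100) := by ring
    have h2 : n * (m ^ d * (d * 100 + 80) + 40) = (d * 100 + 80) * (n * m ^ d) + 40 * n := by ring
    rw [this, h2]
    generalize ∏ i ∈ Finset.range d, N i = T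
    generalize n * m ^ d = Y
    have h3 : T * (d * 100 + 80) + T * 20 = (d * 100 + 100) * T := by ring
    have h4 : (d * 100 + 80) * Y ≤ (d * 100 + 100) * Y := Nat.mul_le_mul_right _ (by omega)
    omega

/-! ### Passing to the next scale -/

/-- The tuple `k` with the coordinates before `i` replaced by `0`. -/
def zeroBelow {d : ℕ} (k : Fin d → ℕ) (i : ℕ) : Fin d → ℕ := fun j => if (j : ℕ) < i then 0 else k j

/-- The tuple `k` with a carry to position `i`. -/
def bump {d : ℕ} (k : Fin d → ℕ) (i : Fin d) : Fin d → ℕ :=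
  fun j => if j < i then 0 else if j = i then k i + 1 else k j

theorem bump_eq {d : ℕ} (k : Fin d → ℕ) (i j : Fin d) :
    bump k i j = zeroBelow k i j + if j = i then 1 else 0 := by
  rw [bump, zeroBelow]
  by_cases h : j = i
  · simp [h]
  · by_cases h' : j < i <;> simp [h, h', Fin.lt_def.mp]

theorem sum_bump {d : ℕ} (k : Fin d → ℕ) (i : Fin d) :
    ∑ j, bump k i j = ∑ j, zeroBelow k i j + 1 := by
  simp [bump_eq, Finset.sum_add_distrib]

theorem zeroBelow_eq {d : ℕ} (k : Fin d → ℕ) (i j : Fin d) :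
    zeroBelow k i j = zeroBelow k (i + 1) j + if j = i then k i else 0 := by
  rw [zeroBelow, zeroBelow]
  have := Fin.ext_iff (a := j) (b := i)
  split_ifs <;> first | omega | simp_all

theorem sum_zeroBelow {d : ℕ} (k : Fin d → ℕ) (i : Fin d) :
    ∑ j, zeroBelow k i j = ∑ j, zeroBelow k (i + 1) j + k i := by
  conv_lhs => simp only [zeroBelow_eq k i, Finset.sum_add_distrib]
  simp

theorem advance_runs {d : ℕ} {q c : ℝ} {k : Fin d → ℕ} {σ : State} (hq : 0 < q) (h0 : σ 0 0 = d)
    (hQ : σ vQ 0 = q) (hF : ∀ i : Fin d, σ aF (i : ℕ) = q ^ k i)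
    (hP : σ vP 0 = c * q ^ ∑ i, k i) :
    Runs advance σ (d * 50 + 60) fun τ =>
      (∃ i : Fin d, (∀ l < i, c * q ^ (∑ j, bump k l j) < 1) ∧ 1 ≤ c * q ^ (∑ j, bump k i j) ∧
        (∀ j : Fin d, τ aF (j : ℕ) = q ^ bump k i j) ∧ τ vP 0 = c * q ^ ∑ j, bump k i j ∧
        τ vRun 0 = σ vRun 0) ∨
      ((∀ l, c * q ^ (∑ j, bump k l j) < 1) ∧ τ vRun 0 = 0) := by
  let J : ℕ → State → Prop := fun r τ => ∃ i, i + r = d ∧ τ vI 0 = i ∧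
    (∀ j : Fin d, τ aF (j : ℕ) = q ^ zeroBelow k i j) ∧
    τ vP 0 = c * q ^ (∑ j, zeroBelow k i j) ∧
    (∀ l : Fin d, (l : ℕ) < i → c * q ^ (∑ j, bump k l j) < 1) ∧
    τ 0 0 = d ∧ τ vQ 0 = q ∧ τ vRun 0 = σ vRun 0
  refine Runs.le (Runs.assign_seq (Runs.seq (Runs.whileLoop (c := 25) J ?_ d _ ?_) (t := 25) ?_)) ?_
  · rintro r τ ⟨i, hir, hI, hF, hP, hl, h0, hQ, hR⟩ hb
    simp only [Cond.Holds, eval_mul, eval_var, eval_const, hI, h0, hP, hQ, Int.cast_one] at hb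
    have hid : i < d := by exact_mod_cast hb.1
    have hFi := hF ⟨i, hid⟩
    have hz := zeroBelow_eq k ⟨i, hid⟩
    have hs := sum_zeroBelow k ⟨i, hid⟩
    have hsb := sum_bump k ⟨i, hid⟩
    simp only at hFi hz hs hsb
    have hzi : zeroBelow k i ⟨i, hid⟩ = k ⟨i, hid⟩ := by simp [zeroBelow]
    rw [hzi] at hFi
    refine ⟨r - 1, by omega, Runs.le (Runs.assign_seq (Runs.set_seq (Runs.assign ?_))) ?_⟩
    · refine ⟨i + 1, by omega, ?_⟩
      simp only [write_same, write_of_ne, ne_eq, Nat.reduceEqDiff, not_false_eq_true, if_true,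
        eval_add, eval_div, eval_var, eval_axis, eval_const, hI, hP, hFi, Int.floor_natCast,
        Int.cast_one, hQ, hR, and_true, OfNat.zero_ne_ofNat, h0, Nat.cast_add, Nat.cast_one,
        true_and]
      refine ⟨fun j => ?_, ?_, fun l hl' => ?_⟩
      · by_cases hj : (j : ℕ) = i
        · simp [hj, zeroBelow]
        · have : ¬ j = ⟨i, hid⟩ := fun h => hj (by rw [h])
          simp [hj, hF, hz j, this]
      · rw [hs, pow_add]
        field_simp
      · rcases Nat.lt_succ_iff_lt_or_eq.mp hl' with h | h
        · exact hl l h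
        · have : l = ⟨i, hid⟩ := Fin.ext h
          rw [this, hsb, pow_succ, ← mul_assoc]
          exact hb.2
    · simp
  · refine ⟨0, by simp, ?_⟩
    simp [write_same, write_of_ne, zeroBelow, hF, hP, h0, hQ]
  · rintro τ ⟨⟨r, i, hir, hI, hF, hP, hl, h0, hQ, hR⟩, hb⟩ -
    simp only [Cond.Holds, eval_mul, eval_var, eval_const, hI, h0, hP, hQ, Int.cast_one] at hb
    refine Runs.le (Runs.ite (fun hb' => Runs.set_seq (Runs.assign ?_))
      (fun hb' => Runs.assign ?_)) ?_
    · left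
      simp only [Cond.Holds, eval_var, hI, h0] at hb'
      have hid : i < d := by exact_mod_cast hb'
      have hFi := hF ⟨i, hid⟩
      have hsb := sum_bump k ⟨i, hid⟩
      simp only at hFi hsb
      have hzi : zeroBelow k i ⟨i, hid⟩ = k ⟨i, hid⟩ := by simp [zeroBelow]
      rw [hzi] at hFi
      have hle : 1 ≤ c * q ^ (∑ j, bump k ⟨i, hid⟩ j) := by
        rw [hsb, pow_succ, ← mul_assoc]
        exact not_lt.mp fun h => hb ⟨hb', h⟩
      refine ⟨⟨i, hid⟩, fun l h => hl l h, hle, ?_⟩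
      simp only [write_same, write_of_ne, ne_eq, Nat.reduceEqDiff, not_false_eq_true, if_true,
        eval_mul, eval_var, eval_axis, hI, hP, hFi, Int.floor_natCast, hQ, hR, and_true]
      refine ⟨fun j => ?_, ?_⟩
      · by_cases hj : (j : ℕ) = i
        · have : j = ⟨i, hid⟩ := Fin.ext hj
          simp [this, bump, pow_succ]
        · have : ¬ j = ⟨i, hid⟩ := fun h => hj (by rw [h])
          simp [hj, hF, bump_eq, this]
      · rw [hsb, pow_succ, ← mul_assoc]
    · right
      simp only [Cond.Holds, eval_var, hI, h0, not_lt] at hb'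
      have hid : d ≤ i := by exact_mod_cast hb'
      exact ⟨fun l => hl l (by omega), by simp [write_same]⟩
    · simp [Cond.cost]
  · simp [Cond.cost]
    omega

theorem setUp_runs {d n : ℕ} {ε : ℝ} {σ : State} (hε : 0 < ε) (h0 : σ 0 0 = d) (hn : σ 0 1 = n)
    (he : σ 0 2 = ε) {m : ℕ} (hm : m = ⌈2 * d / ε⌉₊) :
    Runs setUp σ (d * 50 + 100) fun τ => τ vM 0 = m ∧ τ vQ 0 = 1 - ε / (2 * d) ∧
      τ vP 0 = n + 1 ∧ τ vBest 0 = 0 ∧ τ vRun 0 = 1 ∧ τ vW 0 = (m ^ d : ℕ) ∧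
      ∀ i < d, τ aF (i : ℕ) = 1 := by
  have hmf : -(⌊-(2 * d / ε)⌋ : ℝ) = m := by
    rw [hm, ← Int.cast_neg, ← Int.ceil_neg, neg_neg]
    exact (natCast_ceil_eq_intCast_ceil (by positivity)).symm
  refine Runs.le (Runs.assign_seq (Runs.assign_seq (Runs.assign_seq (Runs.assign_seq
    (Runs.assign_seq (Runs.assign_seq (Runs.imp (Runs.for (N := d) (c := 20) (fun k τ =>
      τ vW 0 = (m ^ k : ℕ) ∧ ∀ i < k, τ aF (i : ℕ) = 1) ?_ ?_ rfl ?_) ?_))))))) ?_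
  · simp [write_same, write_of_ne]
  · intro τ hτ
    simp [hτ 0 rfl, write_of_ne, h0]
  · rintro k τ hk ⟨h1, h2⟩ hI hτ
    have eM : τ vM 0 = m := by
      rw [hτ vM rfl, ← hmf]
      simp [write_of_ne, write_same, h0, he]
    refine Runs.le (Runs.assign_seq (Runs.set ?_)) ?_
    · simp [write_same, write_of_ne, hI, h1, eM, pow_succ]
      intro i hi hik
      exact h2 i (by omega)
    · simp
  · rintro τ ⟨h1, h2⟩ hτ
    refine ⟨?_, ?_, ?_, ?_, ?_, h1, h2⟩
    · rw [hτ vM rfl, ← hmf]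
      simp [write_of_ne, write_same, h0, he]
    all_goals
      rw [hτ _ rfl]
      simp [write_of_ne, write_same, h0, he, hn]
  · simp
    omega

/-! ### The order in which scales are visited -/

/-- The order in which the tuples are visited: the last coordinate in which they differ decides. -/
def Before {d : ℕ} (y k : Fin d → ℕ) : Prop := ∃ i, y i < k i ∧ ∀ j, i < j → y j = k j

section Order

variable {d : ℕ} {y k z : Fin d → ℕ}

theorem Before.trans (h : Before y k) (h' : Before k z) : Before y z := by
  obtain ⟨i, hi, hi'⟩ := h
  obtain ⟨j, hj, hj'⟩ := h'
  rcases lt_trichotomy i j with hij | rfl | hij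
  · exact ⟨j, by rwa [hi' j hij], fun l hl => (hi' l (hij.trans hl)).trans (hj' l hl)⟩
  · exact ⟨i, hi.trans hj, fun l hl => (hi' l hl).trans (hj' l hl)⟩
  · exact ⟨i, by rwa [← hj' i hij], fun l hl => (hi' l hl).trans (hj' l (hij.trans hl))⟩

theorem Before.irrefl : ¬ Before k k := fun ⟨_, h, _⟩ => lt_irrefl _ h

theorem not_before_zero : ¬ Before y 0 := fun ⟨_, h, _⟩ => Nat.not_lt_zero _ h

theorem before_bump (k : Fin d → ℕ) (i : Fin d) : Before k (bump k i) :=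
  ⟨i, by simp [bump], fun j hj => by simp [bump, hj.ne', hj.not_gt]⟩

variable {q c : ℝ}

/-- If all carries to positions before `i` lead out of the admissible tuples, then `k` is the last
admissible tuple among those with the same coordinates from `i` on. -/
theorem eq_or_before (hq : 0 < q) (hq' : q ≤ 1) (hc : 0 < c) {i : ℕ}
    (hl : ∀ l : Fin d, (l : ℕ) < i → c * q ^ (∑ j, bump k l j) < 1)
    (hy : 1 ≤ c * q ^ ∑ j, y j) (h : ∀ j : Fin d, i ≤ j → y j = k j) : y = k ∨ Before y k := by
  by_cases hyk : y = k
  · exact Or.inl hyk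
  right
  obtain ⟨l₀, hl₀⟩ := Function.ne_iff.mp hyk
  obtain ⟨l, hmem, hmax⟩ := (Finset.univ.filter fun l => y l ≠ k l).exists_max_image id
    ⟨l₀, by simpa using hl₀⟩
  simp only [Finset.mem_filter, Finset.mem_univ, true_and, id_eq] at hmem hmax
  have htop : ∀ j, l < j → y j = k j := fun j hj => by
    by_contra hne
    exact absurd (hmax j hne) (not_le.mpr hj)
  rcases lt_or_gt_of_ne hmem with hlt | hlt
  · exact ⟨l, hlt, htop⟩
  · exfalso
    have hli : (l : ℕ) < i := by
      by_contra hge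
      exact hmem (h l (by omega))
    have hle : ∑ j, bump k l j ≤ ∑ j, y j := Finset.sum_le_sum fun j _ => by
      rw [bump]
      split_ifs with h1 h2
      · exact Nat.zero_le _
      · rw [h2]
        exact hlt
      · exact (htop j (lt_of_le_of_ne (not_lt.mp h1) (Ne.symm h2))).ge
    have := mul_le_mul_of_nonneg_left (pow_le_pow_of_le_one hq.le hq' hle) hc.le
    linarith [hl l hli]

/-- Between `k` and its successor there is no admissible tuple. -/
theorem eq_or_before_of_before_bump (hq : 0 < q) (hq' : q ≤ 1) (hc : 0 < c) {i : Fin d}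
    (hl : ∀ l < i, c * q ^ (∑ j, bump k l j) < 1) (hy : 1 ≤ c * q ^ ∑ j, y j)
    (h : Before y (bump k i)) : y = k ∨ Before y k := by
  obtain ⟨j, hj, hj'⟩ := h
  have hij : i ≤ j := by
    by_contra hlt
    simp [bump, not_le.mp hlt] at hj
  rcases hij.lt_or_eq with hij | rfl
  · refine Or.inr ⟨j, by simpa [bump, hij.ne', hij.not_gt] using hj, fun l hl => ?_⟩
    have := hij.trans hl
    rw [hj' l hl]
    simp [bump, this.ne', this.not_gt]
  · have htop : ∀ l, i < l → y l = k l := fun l hl => by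
      rw [hj' l hl]
      simp [bump, hl.ne', hl.not_gt]
    have hle : y i ≤ k i := by
      simp only [bump, lt_self_iff_false, if_false, if_true] at hj
      omega
    rcases hle.lt_or_eq with hlt | heq
    · exact Or.inr ⟨i, hlt, htop⟩
    · refine eq_or_before hq hq' hc (i := i) (fun l h => hl l h) hy fun l h => ?_
      rcases (Fin.le_def.mpr h).lt_or_eq with h | rfl
      · exact htop l h
      · exact heq

end Order

/-! ### The number of scales -/

/-- Weighting a tuple with sum `s` by `(1 + d / K) ^ (-s) ≥ e ^ (-d)` turns the count into a product
of geometric series. -/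
theorem card_le_of_sum_le {d : ℕ} (hd : 1 ≤ d) {K : ℝ} (hK : 0 < K) (S : Finset (Fin d → ℕ))
    (hS : ∀ k ∈ S, ((∑ i, k i : ℕ) : ℝ) ≤ K) : (S.card : ℝ) ≤ (Real.exp 1 * (1 + K / d)) ^ d := by
  have hd' : (0 : ℝ) < d := by exact_mod_cast hd
  set w : ℝ := (1 + d / K)⁻¹ with hw
  have hx : 0 < d / K := by positivity
  have hw0 : 0 < w := by positivity
  have hw1 : w < 1 := inv_lt_one_of_one_lt₀ (by linarith)
  have hinv : (1 - w)⁻¹ = 1 + K / d := by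
    have h1 : 1 - w = d / (K + d) := by
      rw [hw]
      field_simp
      ring
    rw [h1, inv_div, add_div, div_self hd'.ne', add_comm]
  set B := ⌊K⌋₊ + 1
  have hsub : S ⊆ Fintype.piFinset fun _ => Finset.range B := by
    intro k hk
    rw [Fintype.mem_piFinset]
    intro i
    rw [Finset.mem_range, Nat.lt_succ_iff]
    refine Nat.le_floor (le_trans ?_ (hS k hk))
    exact_mod_cast Finset.single_le_sum (fun _ _ => Nat.zero_le _) (Finset.mem_univ i)
  have h1 : ∀ k ∈ S, 1 ≤ Real.exp d * ∏ i, w ^ k i := by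
    intro k hk
    rw [Finset.prod_pow_eq_pow_sum, hw, inv_pow, ← div_eq_mul_inv, one_le_div (by positivity)]
    calc (1 + d / K) ^ (∑ i, k i) ≤ Real.exp (d / K) ^ (∑ i, k i) := by
          gcongr
          linarith [Real.add_one_le_exp (d / K)]
      _ = Real.exp (((∑ i, k i : ℕ) : ℝ) * (d / K)) := (Real.exp_nat_mul _ _).symm
      _ ≤ Real.exp d := by
          gcongr
          calc ((∑ i, k i : ℕ) : ℝ) * (d / K) ≤ K * (d / K) := by gcongr; exact hS k hk
            _ = d := by field_simp
  calc (S.card : ℝ) = ∑ _k ∈ S, (1 : ℝ) := by simp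
    _ ≤ ∑ k ∈ S, Real.exp d * ∏ i, w ^ k i := Finset.sum_le_sum h1
    _ ≤ ∑ k ∈ Fintype.piFinset fun _ => Finset.range B, Real.exp d * ∏ i, w ^ k i :=
        Finset.sum_le_sum_of_subset_of_nonneg hsub fun _ _ _ => by positivity
    _ = Real.exp d * ∏ _i : Fin d, ∑ j ∈ Finset.range B, w ^ j := by
        rw [← Finset.mul_sum, Finset.prod_univ_sum]
    _ = Real.exp d * (∑ j ∈ Finset.range B, w ^ j) ^ d := by simp
    _ ≤ Real.exp d * (1 + K / d) ^ d := by
        gcongr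
        rw [← hinv, ← tsum_geometric_of_lt_one hw0.le hw1]
        exact (summable_geometric_of_lt_one hw0.le hw1).sum_le_tsum _ fun _ _ => by positivity
    _ = _ := by rw [mul_pow, ← Real.exp_nat_mul, mul_one]

/-- There are few tuples `k` with `(n + 1) * (1 - ε / (2 d)) ^ ∑ k ≥ 1`. -/
theorem exists_scales {d n : ℕ} {ε : ℝ} (hd : 1 ≤ d) (hn : 1 ≤ n) (hε : 0 < ε) (hε1 : ε < 1) :
    ∃ S : Finset (Fin d → ℕ),
      (∀ k, k ∈ S ↔ 1 ≤ ((n : ℝ) + 1) * (1 - ε / (2 * d)) ^ ∑ i, k i) ∧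
      (S.card : ℝ) ≤ (Real.exp 1 * (1 + 2 * Real.log (n + 1) / ε)) ^ d := by
  have hd' : (1 : ℝ) ≤ d := by exact_mod_cast hd
  have hn' : (1 : ℝ) ≤ n := by exact_mod_cast hn
  have ha : 0 < ε / (2 * d) := by positivity
  have ha1 : ε / (2 * d) < 1 := by
    rw [div_lt_one (by positivity)]
    linarith
  have hlog : 0 < Real.log (n + 1) := Real.log_pos (by linarith)
  set K : ℝ := Real.log (n + 1) / (ε / (2 * d)) with hK
  have hsum : ∀ k : Fin d → ℕ, 1 ≤ ((n : ℝ) + 1) * (1 - ε / (2 * d)) ^ (∑ i, k i) →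
      ((∑ i, k i : ℕ) : ℝ) ≤ K := by
    intro k hk
    generalize ∑ i, k i = s at hk ⊢
    rw [hK, le_div_iff₀ ha, Real.le_log_iff_exp_le (by positivity)]
    have h1 : (1 - ε / (2 * d)) ^ s ≤ Real.exp (-(s * (ε / (2 * d)))) := by
      rw [← mul_neg, Real.exp_nat_mul]
      exact pow_le_pow_left₀ (by linarith)
        (by linarith [Real.add_one_le_exp (-(ε / (2 * d)))]) s
    have h2 : 1 ≤ ((n : ℝ) + 1) * Real.exp (-(s * (ε / (2 * d)))) :=
      hk.trans (mul_le_mul_of_nonneg_left h1 (by positivity))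
    rwa [Real.exp_neg, ← div_eq_mul_inv, one_le_div (Real.exp_pos _)] at h2
  have hfin : {k : Fin d → ℕ | 1 ≤ ((n : ℝ) + 1) * (1 - ε / (2 * d)) ^ ∑ i, k i}.Finite := by
    refine (Finset.finite_toSet (Fintype.piFinset fun _ => Finset.range (⌊K⌋₊ + 1))).subset ?_
    intro k hk
    rw [Finset.mem_coe, Fintype.mem_piFinset]
    intro i
    rw [Finset.mem_range, Nat.lt_succ_iff]
    refine Nat.le_floor (le_trans ?_ (hsum k hk))
    exact_mod_cast Finset.single_le_sum (fun _ _ => Nat.zero_le _) (Finset.mem_univ i)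
  refine ⟨hfin.toFinset, fun k => by simp, ?_⟩
  have := card_le_of_sum_le hd (K := K) (by positivity) hfin.toFinset fun k hk =>
    hsum k (by simpa using hk)
  have e : K / d = 2 * Real.log (n + 1) / ε := by
    rw [hK]
    field_simp
  rwa [e] at this

/-! ### Grid boxes -/

section Axis

variable {lo hi l h f q : ℝ} {m c : ℕ}

/-- Along one axis, an interval of length more than the relative side `f * q` contains an interval
of the grid with a strictly larger left end; hence it contains each point whose cell is covered
by that grid interval. -/
theorem exists_grid_interval (hw : lo < hi) (hl : lo ≤ l) (hh : h ≤ hi) (hf : 0 < f) (hf' : f ≤ 1)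
    (hq : 0 < q) (hq' : q ≤ 1) (hlen : (hi - lo) * (f * q) < h - l) :
    ∃ c : ℕ, c < gridN m q f ∧ ∀ x, (c : ℤ) ≤ ⌊(x - lo) / ((hi - lo) * f * q / (m + 1))⌋ →
      ⌊(x - lo) / ((hi - lo) * f * q / (m + 1))⌋ < c + m → l < x ∧ x < h := by
  have hw' : 0 < hi - lo := by linarith
  set g := (hi - lo) * f * q / (m + 1) with hg
  have hg0 : 0 < g := by positivity
  have hgm : g * (m + 1) = (hi - lo) * (f * q) := by
    rw [hg]
    field_simp
  set c : ℕ := ⌊(l - lo) / g⌋₊ + 1 with hc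
  have hdiv : 0 ≤ (l - lo) / g := div_nonneg (by linarith) hg0.le
  have h1 : l - lo < g * c := by
    have := Nat.lt_floor_add_one ((l - lo) / g)
    rw [div_lt_iff₀ hg0] at this
    rw [hc]
    push_cast
    linarith
  have h2 : g * c ≤ l - lo + g := by
    have := Nat.floor_le hdiv
    rw [le_div_iff₀ hg0] at this
    rw [hc]
    push_cast
    linarith
  have h3 : g * (c + m) < h - lo := by nlinarith
  refine ⟨c, ?_, fun x hx hx' => ?_⟩
  · have h4 : ((c + m : ℕ) : ℤ) ≤ ⌊((m : ℝ) + 1) / (f * q)⌋ := by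
      rw [Int.le_floor, le_div_iff₀ (by positivity)]
      push_cast
      have : g * (c + m) ≤ hi - lo := by linarith
      rw [hg, div_mul_eq_mul_div, div_le_iff₀ (by positivity)] at this
      nlinarith
    have := gridN_cast (m := m) hq hq' hf hf'
    push_cast at h4
    omega
  · rw [Int.le_floor, le_div_iff₀ hg0] at hx
    rw [Int.floor_lt, div_lt_iff₀ hg0] at hx'
    push_cast at hx hx'
    constructor <;> nlinarith

/-- Along one axis, a grid interval lies in `[lo, hi]`, and it covers the cells of its points. -/
theorem grid_interval (hw : lo < hi) (hf : 0 < f) (hf' : f ≤ 1) (hq : 0 < q) (hq' : q ≤ 1)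
    (hc : c < gridN m q f) {g : ℝ} (hg : g = (hi - lo) * f * q / (m + 1)) :
    lo ≤ lo + g * c ∧ lo + g * (c + m) ≤ hi ∧
      ∀ x, lo + g * c < x → x < lo + g * (c + m) →
        (c : ℤ) ≤ ⌊(x - lo) / g⌋ ∧ ⌊(x - lo) / g⌋ < c + m := by
  have hw' : 0 < hi - lo := by linarith
  have hg0 : 0 < g := by
    rw [hg]
    positivity
  refine ⟨by nlinarith [mul_nonneg hg0.le (Nat.cast_nonneg (α := ℝ) c)], ?_, fun x hx hx' => ?_⟩
  · have := gridN_cast (m := m) hq hq' hf hf'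
    have h4 : ((c + m : ℕ) : ℤ) ≤ ⌊((m : ℝ) + 1) / (f * q)⌋ := by
      push_cast
      omega
    rw [Int.le_floor, le_div_iff₀ (by positivity)] at h4
    push_cast at h4
    have h5 : g * (c + m) ≤ hi - lo := by
      rw [hg, div_mul_eq_mul_div, div_le_iff₀ (by positivity)]
      nlinarith
    linarith
  · rw [Int.le_floor, le_div_iff₀ hg0, Int.floor_lt, div_lt_iff₀ hg0]
    push_cast
    constructor <;> linarith

end Axis

theorem gridN_le {m : ℕ} {q f : ℝ} (hm : 1 ≤ m) (hq : 0 < q) (hq' : q ≤ 1) (hf : 0 < f)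
    (hf' : f ≤ 1) : (gridN m q f : ℝ) ≤ (m + 1) / (f * q) := by
  have h := gridN_cast (m := m) hq hq' hf hf'
  have h1 : ((gridN m q f : ℕ) : ℝ) = (⌊((m : ℝ) + 1) / (f * q)⌋ : ℝ) - m + 1 := by
    exact_mod_cast h
  have h2 : (1 : ℝ) ≤ m := by exact_mod_cast hm
  rw [h1]
  linarith [Int.floor_le (((m : ℝ) + 1) / (f * q))]

theorem volume_openBox {d : ℕ} {l h : Fin d → ℝ} (hlh : ∀ i, l i < h i) :
    (MeasureTheory.volume (openBox l h)).toReal = ∏ i, (h i - l i) :=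
  Real.volume_pi_Ioo_toReal fun i => (hlh i).le

theorem IsEmptyBox.bounds {d n : ℕ} {lo hi l h : Fin d → ℝ} {p : Fin n → Fin d → ℝ}
    (hb : IsEmptyBox lo hi p l h) (i : Fin d) : lo i ≤ l i ∧ h i ≤ hi i := by
  obtain ⟨hlh, hsub, -⟩ := hb
  have hcl := closure_minimal hsub isClosed_Icc
  rw [openBox, closure_pi_set] at hcl
  simp only [closure_Ioo (hlh _).ne] at hcl
  have hl : l ∈ Set.Icc lo hi := hcl fun i _ => ⟨le_rfl, (hlh i).le⟩
  have hh : h ∈ Set.Icc lo hi := hcl fun i _ => ⟨(hlh i).le, le_rfl⟩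
  exact ⟨hl.1 i, hh.2 i⟩

/-- Cut the box into `n + 1` slabs of equal thickness: one of them contains no point. -/
theorem exists_slab {d n : ℕ} (hd : 1 ≤ d) {lo hi : Fin d → ℝ} (hw : ∀ i, lo i < hi i)
    (p : Fin n → Fin d → ℝ) :
    ∃ l h, IsEmptyBox lo hi p l h ∧
      ∏ i, (h i - l i) = (∏ i, (hi i - lo i)) / ((n : ℝ) + 1) := by
  set i₀ : Fin d := ⟨0, by omega⟩
  set w := hi i₀ - lo i₀ with hwdef
  have hw0 : 0 < w := by linarith [hw i₀]
  have hn : (0 : ℝ) < (n : ℝ) + 1 := by positivity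
  let l : ℕ → Fin d → ℝ := fun t => Function.update lo i₀ (lo i₀ + w * t / (n + 1))
  let h : ℕ → Fin d → ℝ := fun t => Function.update hi i₀ (lo i₀ + w * (t + 1) / (n + 1))
  have hmem : ∀ t x, x ∈ openBox (l t) (h t) →
      (t : ℝ) < (x i₀ - lo i₀) * (n + 1) / w ∧ (x i₀ - lo i₀) * (n + 1) / w < t + 1 := by
    intro t x hx
    have := hx i₀ (Set.mem_univ _)
    simp only [l, h, Function.update_self, Set.mem_Ioo] at this
    obtain ⟨h1, h2⟩ := this
    rw [lt_div_iff₀ hw0, div_lt_iff₀ hw0]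
    have h1' : w * t / (n + 1) < x i₀ - lo i₀ := by linarith
    have h2' : x i₀ - lo i₀ < w * (t + 1) / (n + 1) := by linarith
    rw [div_lt_iff₀ hn] at h1'
    rw [lt_div_iff₀ hn] at h2'
    constructor <;> linarith
  have hex : ∃ t : Fin (n + 1), ∀ j, p j ∉ openBox (l t) (h t) := by
    by_contra hcon
    push Not at hcon
    choose j hj using hcon
    have hinj : Function.Injective j := by
      intro s t hst
      have h1 := hmem s _ (hj s)
      have h2 := hmem t _ (hj t)
      rw [← hst] at h2
      have h3 : ((s : ℕ) : ℝ) < (t : ℕ) + 1 := by linarith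
      have h4 : ((t : ℕ) : ℝ) < (s : ℕ) + 1 := by linarith
      norm_cast at h3 h4
      exact Fin.ext (by omega)
    simpa using Fintype.card_le_of_injective j hinj
  obtain ⟨t, ht⟩ := hex
  have htn : ((t : ℕ) : ℝ) + 1 ≤ n + 1 := by exact_mod_cast t.2
  have hle : w * (t + 1) / (n + 1) ≤ w := by
    rw [div_le_iff₀ hn]
    exact mul_le_mul_of_nonneg_left htn hw0.le
  have hlt : w * (t : ℕ) / (n + 1) < w * ((t : ℕ) + 1) / (n + 1) := by
    gcongr
    linarith
  have hpos : 0 ≤ w * (t : ℕ) / (n + 1) := by positivity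
  refine ⟨l t, h t, ⟨fun i => ?_, fun x hx => ⟨fun i => ?_, fun i => ?_⟩, ht⟩, ?_⟩
  · by_cases hi : i = i₀
    · subst hi
      simp only [l, h, Function.update_self]
      linarith
    · simpa [l, h, hi] using hw i
  · have := (hx i (Set.mem_univ _)).1
    by_cases hi : i = i₀
    · rw [hi] at this ⊢
      simp only [l, Function.update_self] at this
      linarith
    · simp only [l, Function.update_of_ne hi] at this
      exact this.le
  · have := (hx i (Set.mem_univ _)).2
    by_cases hi' : i = i₀
    · rw [hi'] at this ⊢
      simp only [h, Function.update_self] at this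
      linarith
    · simp only [h, Function.update_of_ne hi'] at this
      exact this.le
  · rw [← Finset.mul_prod_erase _ _ (Finset.mem_univ i₀),
      ← Finset.mul_prod_erase Finset.univ (fun i => hi i - lo i) (Finset.mem_univ i₀)]
    have : ∏ x ∈ Finset.univ.erase i₀, (h t x - l t x)
        = ∏ x ∈ Finset.univ.erase i₀, (hi x - lo x) := by
      refine Finset.prod_congr rfl fun i hi => ?_
      have := Finset.ne_of_mem_erase hi
      simp [l, h, this]
    rw [this]
    simp only [l, h, Function.update_self, ← hwdef]
    field_simp
    ring

/-- The loss of volume in passing from an empty box to the grid is at most the factor `1 - ε`. -/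
theorem one_sub_le_pow {d m : ℕ} {ε : ℝ} (hd : 1 ≤ d) (hε : 0 < ε) (hε1 : ε < 1)
    (hm : 2 * d / ε ≤ m) : 1 - ε ≤ ((1 - ε / (2 * d)) * m / (m + 1)) ^ d := by
  have hd' : (1 : ℝ) ≤ d := by exact_mod_cast hd
  have hm0 : (0 : ℝ) < m := lt_of_lt_of_le (by positivity) hm
  have h1 : (1 : ℝ) / (m + 1) ≤ ε / (2 * d) := by
    rw [div_le_div_iff₀ (by positivity) (by positivity)]
    rw [div_le_iff₀ hε] at hm
    nlinarith
  have ha1 : ε / (2 * d) ≤ 1 := by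
    rw [div_le_one (by positivity)]
    linarith
  have h2 : 1 + -(ε / d) ≤ (1 - ε / (2 * d)) * m / (m + 1) := by
    have e : (1 - ε / (2 * d)) * m / (m + 1) = (1 - ε / (2 * d)) * (1 - 1 / ((m : ℝ) + 1)) := by
      field_simp
      ring
    have e' : ε / d = 2 * (ε / (2 * d)) := by field_simp
    have h3 : 0 ≤ 1 - ε / (2 * d) := by linarith
    rw [e, e']
    nlinarith [mul_le_mul_of_nonneg_left h1 h3, div_pos hε (by positivity : (0 : ℝ) < 2 * d)]
  have h4 : ε / d ≤ 1 := by
    rw [div_le_one (by positivity)]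
    linarith
  calc 1 - ε = 1 + d * -(ε / d) := by field_simp; ring
    _ ≤ (1 + -(ε / d)) ^ d := one_add_mul_le_pow (by linarith) d
    _ ≤ _ := pow_le_pow_left₀ (by linarith) h2 d

/-! ### The grids of an instance -/

section Grid

variable {d : ℕ} (q : ℝ) (k : Fin d → ℕ)

/-- The relative sides `q ^ k i` of the scale `k`, extended by `1` to all natural numbers. -/
noncomputable def side (i : ℕ) : ℝ := if h : i < d then q ^ k ⟨i, h⟩ else 1

theorem side_fin (i : Fin d) : side q k i = q ^ k i := by simp [side]

variable {q}

theorem side_pos (hq : 0 < q) (i : ℕ) : 0 < side q k i := by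
  rw [side]
  split_ifs <;> positivity

theorem side_le_one (hq : 0 < q) (hq' : q ≤ 1) (i : ℕ) : side q k i ≤ 1 := by
  rw [side]
  split_ifs
  · exact pow_le_one₀ hq.le hq'
  · exact le_rfl

variable (m : ℕ) (q) (lo hi : Fin d → ℝ)

/-- The numbers of positions along the axes at the scale `k`. -/
noncomputable def counts (i : ℕ) : ℕ := gridN m q (side q k i)

/-- The grid spacing along axis `i` at the scale `k`. -/
noncomputable def spacing (i : Fin d) : ℝ := (hi i - lo i) * q ^ k i * q / (m + 1)

/-- Box number `x` of the grid at the scale `k` contains no point, also not on the lower faces. -/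
def Free {n : ℕ} (p : Fin n → Fin d → ℝ) (x : ℕ) : Prop :=
  x < ∏ i ∈ Finset.range d, counts q k m i ∧
    ∀ j, ¬ ∀ i : Fin d, (digit (counts q k m) x i : ℤ) ≤ ⌊(p j i - lo i) / spacing q k m lo hi i⌋ ∧
      ⌊(p j i - lo i) / spacing q k m lo hi i⌋ < digit (counts q k m) x i + m

/-- `l`, `h` are the corners of box number `x` of the grid at the scale `k`. -/
def IsGridBox (x : ℕ) (l h : Fin d → ℝ) : Prop :=
  ∀ i : Fin d, l i = lo i + spacing q k m lo hi i * digit (counts q k m) x i ∧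
    h i = lo i + spacing q k m lo hi i * (digit (counts q k m) x i + m)

variable {q k m lo hi}

theorem counts_pos (hq : 0 < q) (hq' : q ≤ 1) (i : ℕ) : 0 < counts q k m i :=
  gridN_pos hq hq' (side_pos k hq i) (side_le_one k hq hq' i)

theorem prod_counts_le (hm : 1 ≤ m) (hq : 0 < q) (hq' : q ≤ 1) :
    ((∏ i ∈ Finset.range d, counts q k m i : ℕ) : ℝ)
      ≤ ((m : ℝ) + 1) ^ d / (q ^ (∑ i, k i) * q ^ d) := by
  rw [← Fin.prod_univ_eq_prod_range (fun i => counts q k m i) d, Nat.cast_prod]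
  calc ∏ i : Fin d, (counts q k m i : ℝ) ≤ ∏ i : Fin d, ((m : ℝ) + 1) / (q ^ k i * q) :=
        Finset.prod_le_prod (fun _ _ => by positivity) fun i _ => by
          rw [← side_fin]
          exact gridN_le hm hq hq' (side_pos k hq i) (side_le_one k hq hq' i)
    _ = _ := by
        rw [Finset.prod_div_distrib, Finset.prod_mul_distrib, Finset.prod_pow_eq_pow_sum]
        simp

/-- A free grid box is an empty box, and its volume depends on the scale only. -/
theorem Free.isEmptyBox {n x : ℕ} {p : Fin n → Fin d → ℝ} {l h : Fin d → ℝ} (hm : 1 ≤ m)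
    (hq : 0 < q) (hq' : q ≤ 1) (hw : ∀ i, lo i < hi i) (hx : Free q k m lo hi p x)
    (hb : IsGridBox q k m lo hi x l h) :
    IsEmptyBox lo hi p l h ∧ (MeasureTheory.volume (openBox l h)).toReal
      = (∏ i, (hi i - lo i)) * q ^ (∑ i, k i) * (q * m / (m + 1)) ^ d := by
  have hm' : (1 : ℝ) ≤ m := by exact_mod_cast hm
  have hside : ∀ i : Fin d, 0 < q ^ k i ∧ q ^ k i ≤ 1 := fun i =>
    ⟨by positivity, pow_le_one₀ hq.le hq'⟩
  have hg : ∀ i, 0 < spacing q k m lo hi i := fun i => by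
    have := hw i
    have := (hside i).1
    rw [spacing]
    have : 0 < hi i - lo i := by linarith
    positivity
  have hdig : ∀ i : Fin d, digit (counts q k m) x i < gridN m q (q ^ k i) := fun i => by
    have := digit_lt (x := x) (counts_pos (k := k) (m := m) hq hq' i)
    rwa [counts, side_fin] at this
  have haxis := fun i => grid_interval (hw i) (hside i).1 (hside i).2 hq hq' (hdig i)
    (g := spacing q k m lo hi i) rfl
  have hlh : ∀ i, l i < h i := fun i => by
    rw [(hb i).1, (hb i).2]
    nlinarith [hg i]
  refine ⟨⟨hlh, fun y hy => ⟨fun i => ?_, fun i => ?_⟩, fun j hj => hx.2 j fun i => ?_⟩, ?_⟩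
  · have := (hy i (Set.mem_univ _)).1
    rw [(hb i).1] at this
    linarith [(haxis i).1]
  · have := (hy i (Set.mem_univ _)).2
    rw [(hb i).2] at this
    linarith [(haxis i).2.1]
  · have := hj i (Set.mem_univ _)
    simp only [Set.mem_Ioo, (hb i).1, (hb i).2] at this
    exact (haxis i).2.2 _ this.1 this.2
  · rw [volume_openBox hlh]
    calc ∏ i, (h i - l i) = ∏ i, (hi i - lo i) * q ^ k i * (q * m / (m + 1)) :=
          Finset.prod_congr rfl fun i _ => by
            rw [(hb i).1, (hb i).2, spacing]
            field_simp
            ring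
      _ = _ := by
          rw [Finset.prod_mul_distrib, Finset.prod_mul_distrib, Finset.prod_pow_eq_pow_sum,
            Finset.prod_const, Finset.card_univ, Fintype.card_fin]

/-- Round the relative sides of an empty box down to powers of `q`, and move it to the grid. -/
theorem IsEmptyBox.exists_free {n : ℕ} {p : Fin n → Fin d → ℝ} {l h : Fin d → ℝ}
    (hq : 0 < q) (hq' : q < 1) (hw : ∀ i, lo i < hi i) (hb : IsEmptyBox lo hi p l h) :
    ∃ (k : Fin d → ℕ) (x : ℕ), Free q k m lo hi p x ∧
      ∏ i, (h i - l i) ≤ (∏ i, (hi i - lo i)) * q ^ ∑ i, k i := by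
  have hbd := hb.bounds
  have hex : ∀ i, ∃ k : ℕ, q ^ (k + 1) < (h i - l i) / (hi i - lo i) ∧
      (h i - l i) / (hi i - lo i) ≤ q ^ k := fun i => by
    have h1 := hw i
    have h2 := hb.1 i
    have h3 := hbd i
    refine exists_nat_pow_near_of_lt_one (div_pos (by linarith) (by linarith)) ?_ hq hq'
    rw [div_le_one (by linarith)]
    linarith
  choose k hk hk' using hex
  have haxis : ∀ i : Fin d, _ := fun i => exists_grid_interval (m := m) (f := q ^ k i) (q := q)
    (hw i) (hbd i).1 (hbd i).2 (by positivity) (pow_le_one₀ hq.le hq'.le) hq hq'.le (by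
      have h1 : 0 < hi i - lo i := by linarith [hw i]
      have := hk i
      rw [lt_div_iff₀ h1, pow_succ] at this
      linarith)
  choose c hc hcov using haxis
  let c' : ℕ → ℕ := fun i => if h : i < d then c ⟨i, h⟩ else 0
  have hc' : ∀ i < d, c' i < counts q k m i := fun i hi => by
    simp only [c', hi, dif_pos]
    have := hc ⟨i, hi⟩
    rw [← side_fin] at this
    exact this
  refine ⟨k, encode (counts q k m) c' d, ⟨encode_lt hc', fun j hj => ?_⟩, ?_⟩
  · refine hb.2.2 j fun i _ => ?_
    have := hj i
    rw [digit_encode hc' i.2] at this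
    simp only [c', i.2, dif_pos] at this
    exact hcov i _ this.1 this.2
  · calc ∏ i, (h i - l i) ≤ ∏ i, (hi i - lo i) * q ^ k i :=
          Finset.prod_le_prod (fun i _ => by linarith [hb.1 i]) fun i _ => by
            have := hk' i
            rw [div_le_iff₀ (by linarith [hw i])] at this
            linarith
      _ = _ := by rw [Finset.prod_mul_distrib, Finset.prod_pow_eq_pow_sum]

end Grid

/-! ### Correctness and running time of the program -/

/-- After the scales in `D` have been treated, either no free grid box was found, or the output
holds one of the largest free grid boxes of these scales.  The recorded quantity
`c * q ^ ∑ i, k i` is proportional to the volume of the boxes of the scale `k`. -/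
def BestOf {d n : ℕ} (q c : ℝ) (m : ℕ) (lo hi : Fin d → ℝ) (p : Fin n → Fin d → ℝ)
    (D : Finset (Fin d → ℕ)) (b : ℝ) (l h : Fin d → ℝ) : Prop :=
  (b = 0 ∨ ∃ k x, Free q k m lo hi p x ∧ b = c * q ^ (∑ i, k i) ∧ IsGridBox q k m lo hi x l h) ∧
    ∀ y ∈ D, ∀ x, Free q y m lo hi p x → c * q ^ (∑ i, y i) ≤ b

theorem treatScale_bestOf {d n m : ℕ} {q c ε : ℝ} {lo hi : Fin d → ℝ} {p : Fin n → Fin d → ℝ}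
    {D : Finset (Fin d → ℕ)} {k : Fin d → ℕ} {σ : State} (hin : HoldsInput σ ε lo hi p)
    (hq : 0 < q) (hq' : q ≤ 1) (hM : σ vM 0 = m) (hW : σ vW 0 = (m ^ d : ℕ))
    (hQ : σ vQ 0 = q) (hF : ∀ i : Fin d, σ aF (i : ℕ) = q ^ k i)
    (hP : σ vP 0 = c * q ^ ∑ i, k i)
    (hbest : BestOf q c m lo hi p D (σ vBest 0) (readPoint d σ outL) (readPoint d σ outH)) :
    Runs treatScale σ ((d * 100 + 100) *
        (∏ i ∈ Finset.range d, counts q k m i + n * m ^ d + n + 1)) fun τ =>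
      BestOf q c m lo hi p (insert k D) (τ vBest 0) (readPoint d τ outL) (readPoint d τ outH) := by
  obtain ⟨h0, hn, -, hlo, hhi, hp⟩ := hin
  have hsp : ∀ i : Fin d, (σ aHi (i : ℕ) - σ aLo (i : ℕ)) * side q k i * q / (m + 1)
      = spacing q k m lo hi i := fun i => by rw [hlo, hhi, side_fin, spacing]
  have hfree : ∀ x, (x < ∏ i ∈ Finset.range d, counts q k m i ∧
      ∀ j < n, ¬ Covers d m (counts q k m) (fun i => ⌊(σ aPt (j * d + i : ℕ) - σ aLo (i : ℕ)) /
        ((σ aHi (i : ℕ) - σ aLo (i : ℕ)) * side q k i * q / (m + 1))⌋) x) ↔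
      Free q k m lo hi p x := by
    intro x
    rw [Free]
    refine and_congr_right fun _ => ?_
    rw [← Fin.forall_iff (p := fun j : Fin n => ¬ Covers d m (counts q k m) (fun i =>
      ⌊(σ aPt ((j : ℕ) * d + i : ℕ) - σ aLo (i : ℕ)) /
        ((σ aHi (i : ℕ) - σ aLo (i : ℕ)) * side q k i * q / (m + 1))⌋) x)]
    refine forall_congr' fun j => not_congr ?_
    rw [Covers, ← Fin.forall_iff (p := fun i : Fin d => (digit (counts q k m) x i : ℤ) ≤
      ⌊(σ aPt ((j : ℕ) * d + i : ℕ) - σ aLo (i : ℕ)) /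
        ((σ aHi (i : ℕ) - σ aLo (i : ℕ)) * side q k i * q / (m + 1))⌋ ∧
      ⌊(σ aPt ((j : ℕ) * d + i : ℕ) - σ aLo (i : ℕ)) /
        ((σ aHi (i : ℕ) - σ aLo (i : ℕ)) * side q k i * q / (m + 1))⌋ <
        digit (counts q k m) x i + m)]
    refine forall_congr' fun i => ?_
    rw [hsp, hp, hlo]
  refine Runs.imp (treatScale_runs h0 hn hM hW hQ (f := side q k) (N := counts q k m)
    (fun i hi => ?_) hq hq' (fun i _ => ⟨side_pos k hq i, side_le_one k hq hq' i⟩)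
    (fun i => rfl) (fun i => rfl) (fun j i => rfl)) ?_
  · have := hF ⟨i, hi⟩
    rwa [← side_fin] at this
  · rintro τ (⟨x, hx, hcov, hlt, hb, hout⟩ | ⟨hb, hl, hh, hno⟩) -
    · rw [hP] at hlt hb
      refine ⟨Or.inr ⟨k, x, (hfree x).mp ⟨hx, hcov⟩, hb, fun i => ?_⟩, fun y hy z hz => ?_⟩
      · have := hout i i.2
        rw [hsp, hlo] at this
        exact this
      · rw [hb]
        rcases Finset.mem_insert.mp hy with rfl | hy
        · exact le_rfl
        · exact (hbest.2 y hy z hz).trans hlt.le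
    · have el : readPoint d τ outL = readPoint d σ outL := by
        funext i
        rw [readPoint, readPoint, hl]
      have eh : readPoint d τ outH = readPoint d σ outH := by
        funext i
        rw [readPoint, readPoint, hh]
      rw [hb, el, eh]
      refine ⟨hbest.1, fun y hy z hz => ?_⟩
      rcases Finset.mem_insert.mp hy with rfl | hy
      · by_contra hlt
        rw [not_le] at hlt
        have := (hfree z).mpr hz
        exact hno (by rwa [hP]) z this.1 this.2
      · exact hbest.2 y hy z hz

theorem HoldsInput.congr {d n : ℕ} {ε : ℝ} {lo hi : Fin d → ℝ} {p : Fin n → Fin d → ℝ}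
    {σ τ : State} (h : HoldsInput σ ε lo hi p) (h0 : τ 0 = σ 0) (h1 : τ aLo = σ aLo)
    (h2 : τ aHi = σ aHi) (h3 : τ aPt = σ aPt) : HoldsInput τ ε lo hi p := by
  rw [HoldsInput, h0, h1, h2, h3]
  exact h

theorem largestEmptyBox_runs {d n m T : ℕ} {q ε : ℝ} {lo hi : Fin d → ℝ}
    {p : Fin n → Fin d → ℝ} {S : Finset (Fin d → ℕ)} {σ : State} (hin : HoldsInput σ ε lo hi p)
    (hε : 0 < ε) (hq : 0 < q) (hq' : q ≤ 1) (hqd : q = 1 - ε / (2 * d)) (hm : m = ⌈2 * d / ε⌉₊)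
    (hS : ∀ k, k ∈ S ↔ 1 ≤ ((n : ℝ) + 1) * q ^ ∑ i, k i)
    (hT : ∀ k ∈ S, ∏ i ∈ Finset.range d, counts q k m i ≤ T) :
    Runs largestEmptyBox σ (S.card * ((d * 100 + 100) * (T + n * m ^ d + n + 1) + d * 50 + 70)
      + d * 50 + 110) fun τ =>
      BestOf q (n + 1) m lo hi p S (τ vBest 0) (readPoint d τ outL) (readPoint d τ outH) := by
  classical
  have hc : (0 : ℝ) < n + 1 := by positivity
  let J : ℕ → State → Prop := fun r τ =>
    (HoldsInput τ ε lo hi p ∧ τ vM 0 = m ∧ τ vQ 0 = q ∧ τ vW 0 = (m ^ d : ℕ)) ∧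
    ((τ vRun 0 = 1 ∧ ∃ k ∈ S, (∀ i : Fin d, τ aF (i : ℕ) = q ^ k i) ∧
        τ vP 0 = (n + 1) * q ^ (∑ i, k i) ∧ r + (S.filter (Before · k)).card = S.card ∧
        BestOf q (n + 1) m lo hi p (S.filter (Before · k)) (τ vBest 0) (readPoint d τ outL)
          (readPoint d τ outH)) ∨
      τ vRun 0 = 0 ∧
        BestOf q (n + 1) m lo hi p S (τ vBest 0) (readPoint d τ outL) (readPoint d τ outH))
  refine Runs.le (Runs.seq (setUp_runs hε hin.1 hin.2.1 hin.2.2.1 hm) fun σ₁ h₁ fr =>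
    Runs.imp (Runs.whileLoop (c := (d * 100 + 100) * (T + n * m ^ d + n + 1) + (d * 50 + 60)) J ?_
      S.card σ₁ ?_) ?_) ?_
  · rintro r τ ⟨⟨hin, hM, hQ, hW⟩, hJ⟩ hb
    simp only [Cond.Holds, eval_const, eval_var, Int.cast_zero] at hb
    obtain ⟨hR, k, hkS, hF, hP, hr, hbest⟩ | ⟨hR, -⟩ := hJ
    swap
    · rw [hR] at hb
      exact absurd hb (lt_irrefl _)
    have hkD : k ∉ S.filter (Before · k) := fun h => Before.irrefl (Finset.mem_filter.mp h).2
    have hlt : (S.filter (Before · k)).card < S.card := Finset.card_lt_card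
      ⟨Finset.filter_subset _ _, fun h => hkD (h hkS)⟩
    refine ⟨r - 1, by omega, Runs.seq (Runs.le (treatScale_bestOf hin hq hq' hM hW hQ hF hP hbest)
      ?_) fun υ hυ fr => Runs.imp (advance_runs (d := d) (c := n + 1) (k := k) hq ?_ ?_ ?_ ?_) ?_⟩
    · have := hT k hkS
      gcongr
    · rw [fr 0 rfl, hin.1]
    · rw [fr vQ rfl, hQ]
    · rw [fr aF rfl]
      exact hF
    · rw [fr vP rfl, hP]
    · intro ω hω fr'
      have eb : ω vBest = υ vBest := fr' vBest rfl
      have el : readPoint d ω outL = readPoint d υ outL := by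
        funext i
        rw [readPoint, readPoint, fr' outL rfl]
      have eh : readPoint d ω outH = readPoint d υ outH := by
        funext i
        rw [readPoint, readPoint, fr' outH rfl]
      refine ⟨⟨hin.congr (by rw [fr' _ rfl, fr _ rfl]) (by rw [fr' _ rfl, fr _ rfl])
        (by rw [fr' _ rfl, fr _ rfl]) (by rw [fr' _ rfl, fr _ rfl]),
        by rw [fr' vM rfl, fr vM rfl, hM], by rw [fr' vQ rfl, fr vQ rfl, hQ],
        by rw [fr' vW rfl, fr vW rfl, hW]⟩, ?_⟩
      rw [eb, el, eh]
      rcases hω with ⟨i, hl, hadm, hF', hP', hR'⟩ | ⟨hl, hR'⟩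
      · left
        have hD : S.filter (Before · (bump k i)) = insert k (S.filter (Before · k)) := by
          ext y
          simp only [Finset.mem_filter, Finset.mem_insert]
          constructor
          · rintro ⟨hy, hyb⟩
            rcases eq_or_before_of_before_bump hq hq' hc hl ((hS y).mp hy) hyb with h | h
            · exact Or.inl h
            · exact Or.inr ⟨hy, h⟩
          · rintro (rfl | ⟨hy, hyb⟩)
            · exact ⟨hkS, before_bump _ _⟩
            · exact ⟨hy, hyb.trans (before_bump _ _)⟩
        refine ⟨by rw [hR', fr vRun rfl, hR], bump k i, (hS _).mpr hadm, hF', hP', ?_, ?_⟩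
        · rw [hD, Finset.card_insert_of_notMem hkD]
          omega
        · rw [hD]
          exact hυ
      · right
        have hD : S = insert k (S.filter (Before · k)) := by
          ext y
          simp only [Finset.mem_filter, Finset.mem_insert]
          constructor
          · intro hy
            rcases eq_or_before hq hq' hc (i := d) (fun l _ => hl l) ((hS y).mp hy)
              (fun j hj => absurd j.2 (by omega)) with h | h
            · exact Or.inl h
            · exact Or.inr ⟨hy, h⟩
          · rintro (rfl | ⟨hy, -⟩)
            · exact hkS
            · exact hy
        refine ⟨hR', ?_⟩
        rw [hD]
        exact hυ
  · obtain ⟨hM, hQ, hP, hB, hR, hW, hF⟩ := h₁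
    have hD : S.filter (Before · 0) = ∅ := Finset.filter_false_of_mem fun _ _ => not_before_zero
    refine ⟨⟨hin.congr (fr _ rfl) (fr _ rfl) (fr _ rfl) (fr _ rfl), hM, by rw [hQ, hqd], hW⟩,
      Or.inl ⟨hR, 0, (hS 0).mpr (by simp), fun i => by simp [hF i i.2], by simp [hP], by simp [hD],
        Or.inl hB, ?_⟩⟩
    simp [hD]
  · rintro τ ⟨⟨r, -, ⟨hR, -⟩ | ⟨-, h⟩⟩, hb⟩ -
    · simp [Cond.Holds, hR] at hb
    · exact h
  · simp only [Cond.cost, cost_const, cost_var]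
    have : S.card * (1 + 2 + 1 + ((d * 100 + 100) * (T + n * m ^ d + n + 1) + (d * 50 + 60)) + 1)
        ≤ S.card * ((d * 100 + 100) * (T + n * m ^ d + n + 1) + d * 50 + 70) :=
      Nat.mul_le_mul_left _ (by omega)
    omega

/-- A largest free grid box is an approximately largest empty box. -/
theorem BestOf.isApproxMaxEmptyBox {d n m : ℕ} {q ε b : ℝ} {lo hi l h : Fin d → ℝ}
    {p : Fin n → Fin d → ℝ} {S : Finset (Fin d → ℕ)} (hd : 1 ≤ d) (hε : 0 < ε) (hε1 : ε < 1)
    (hq : 0 < q) (hq1 : q < 1) (hqd : q = 1 - ε / (2 * d)) (hm : 2 * d / ε ≤ m)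
    (hw : ∀ i, lo i < hi i) (hS : ∀ k, k ∈ S ↔ 1 ≤ ((n : ℝ) + 1) * q ^ ∑ i, k i)
    (hbest : BestOf q (n + 1) m lo hi p S b l h) : IsApproxMaxEmptyBox ε lo hi p l h := by
  have hn : (0 : ℝ) < (n : ℝ) + 1 := by positivity
  have hvol : 0 < ∏ i, (hi i - lo i) := Finset.prod_pos fun i _ => by linarith [hw i]
  have hm1 : 1 ≤ m := by
    have hd' : (1 : ℝ) ≤ d := by exact_mod_cast hd
    have : (0 : ℝ) < m := lt_of_lt_of_le (by positivity) hm
    exact_mod_cast this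
  -- Empty boxes of relative volume at least `1 / (n + 1)` are represented at some visited scale.
  have key : ∀ l' h', IsEmptyBox lo hi p l' h' →
      (∏ i, (hi i - lo i)) / ((n : ℝ) + 1) ≤ ∏ i, (h' i - l' i) →
      1 ≤ b ∧ ((n : ℝ) + 1) * ∏ i, (h' i - l' i) ≤ (∏ i, (hi i - lo i)) * b := by
    intro l' h' hb hle
    obtain ⟨k, x, hx, hk⟩ := hb.exists_free (m := m) hq hq1 hw
    have hkS : 1 ≤ ((n : ℝ) + 1) * q ^ ∑ i, k i := by
      have := hle.trans hk
      rw [div_le_iff₀ hn] at this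
      have h2 : (∏ i, (hi i - lo i)) * 1
          ≤ (∏ i, (hi i - lo i)) * (((n : ℝ) + 1) * q ^ ∑ i, k i) := by linarith
      exact le_of_mul_le_mul_left h2 hvol
    have h1 := hbest.2 k ((hS k).mpr hkS) x hx
    refine ⟨hkS.trans h1, ?_⟩
    calc ((n : ℝ) + 1) * ∏ i, (h' i - l' i)
        ≤ (n + 1) * ((∏ i, (hi i - lo i)) * q ^ ∑ i, k i) := by gcongr
      _ = (∏ i, (hi i - lo i)) * ((n + 1) * q ^ ∑ i, k i) := by ring
      _ ≤ _ := by gcongr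
  obtain ⟨l₀, h₀, hb₀, hv₀⟩ := exists_slab (n := n) hd hw p
  obtain ⟨hb1, -⟩ := key l₀ h₀ hb₀ hv₀.ge
  obtain hb0 | ⟨k, x, hx, hbk, hgrid⟩ := hbest.1
  · linarith
  obtain ⟨hempty, hv⟩ := hx.isEmptyBox hm1 hq hq1.le hw hgrid
  refine ⟨hempty, fun l' h' hb' => ?_⟩
  have hloss : 1 - ε ≤ (q * m / (m + 1)) ^ d := by
    rw [hqd]
    exact one_sub_le_pow hd hε hε1 hm
  rw [hv, volume_openBox hb'.1]
  have hmain : ∏ i, (h' i - l' i) ≤ (∏ i, (hi i - lo i)) * q ^ ∑ i, k i := by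
    rcases le_total ((∏ i, (hi i - lo i)) / ((n : ℝ) + 1)) (∏ i, (h' i - l' i)) with hle | hle
    · have := (key l' h' hb' hle).2
      rw [hbk] at this
      have h2 : ((n : ℝ) + 1) * ∏ i, (h' i - l' i)
          ≤ (n + 1) * ((∏ i, (hi i - lo i)) * q ^ ∑ i, k i) := by linarith
      exact le_of_mul_le_mul_left h2 hn
    · refine hle.trans ?_
      rw [div_le_iff₀ hn, mul_assoc]
      refine le_mul_of_one_le_right hvol.le ?_
      rw [mul_comm, ← hbk]
      exact hb1
  calc (1 - ε) * ∏ i, (h' i - l' i)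
      ≤ (q * m / (m + 1)) ^ d * ((∏ i, (hi i - lo i)) * q ^ ∑ i, k i) := by
        refine mul_le_mul hloss hmain (Finset.prod_nonneg fun i _ => ?_) (by positivity)
        linarith [hb'.1 i]
    _ = _ := by ring

theorem log_add_one_le {n : ℕ} (hn : 2 ≤ n) :
    Real.log (n + 1) ≤ 5 / 4 * Real.logb 2 n ∧ 1 ≤ Real.logb 2 n := by
  have hn' : (2 : ℝ) ≤ n := by exact_mod_cast hn
  have hL : 1 ≤ Real.logb 2 n := by
    rw [Real.le_logb_iff_rpow_le (by norm_num) (by linarith)]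
    simpa using hn'
  refine ⟨?_, hL⟩
  have h1 : Real.log n = Real.log 2 * Real.logb 2 n := by
    rw [Real.logb]
    field_simp
  have h2 : Real.log ((n : ℝ) + 1) ≤ Real.log n + Real.log (3 / 2) := by
    rw [← Real.log_mul (by positivity) (by norm_num)]
    exact Real.log_le_log (by positivity) (by linarith)
  have h3 : Real.log 2 + Real.log (3 / 2) ≤ 5 / 4 := by
    rw [← Real.log_mul (by norm_num) (by norm_num), Real.log_le_iff_le_exp (by norm_num)]
    have := Real.quadratic_le_exp_of_nonneg (x := 5 / 4) (by norm_num)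
    norm_num at this ⊢
    linarith
  have h4 : 0 ≤ Real.log (3 / 2) := Real.log_nonneg (by norm_num)
  nlinarith

/-- The number of scales times the work per scale. -/
theorem time_bound {d n m s : ℕ} {ε : ℝ} (hd : 1 ≤ d) (hn : 2 ≤ n) (hε : 0 < ε) (hε1 : ε < 1)
    (hm : m = ⌈2 * d / ε⌉₊) (hs1 : 1 ≤ s)
    (hs : (s : ℝ) ≤ (Real.exp 1 * (1 + 2 * Real.log (n + 1) / ε)) ^ d) :
    ((s * ((d * 100 + 100) * (2 * (n + 1) * (m + 1) ^ d + n * m ^ d + n + 1) + d * 50 + 70)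
      + d * 50 + 110 : ℕ) : ℝ)
      ≤ 42000 * ((8 * Real.exp 1 * d / ε ^ 2) ^ d * n * Real.logb 2 n ^ d) := by
  have hd' : (1 : ℝ) ≤ d := by exact_mod_cast hd
  have hn' : (2 : ℝ) ≤ n := by exact_mod_cast hn
  obtain ⟨hlog, hL⟩ := log_add_one_le hn
  set L := Real.logb 2 n with hLdef
  -- In terms of `X = (m + 1) ^ d` the time is `O(s d n X)`.
  have h1 : s * ((d * 100 + 100) * (2 * (n + 1) * (m + 1) ^ d + n * m ^ d + n + 1) + d * 50 + 70)
      + d * 50 + 110 ≤ 2000 * (s * (d * (n * (m + 1) ^ d))) := by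
    have hX : 1 ≤ (m + 1) ^ d := Nat.one_le_pow _ _ (by omega)
    have hmX : m ^ d ≤ (m + 1) ^ d := Nat.pow_le_pow_left (by omega) d
    set X := (m + 1) ^ d
    have hY : n ≤ n * X := Nat.le_mul_of_pos_right n hX
    have hmY : n * m ^ d ≤ n * X := Nat.mul_le_mul_left n hmX
    have hXY : 2 * X ≤ n * X := Nat.mul_le_mul_right X hn
    have e : 2 * (n + 1) * X = 2 * (n * X) + 2 * X := by ring
    set Y := n * X
    have hZ : d ≤ d * Y := Nat.le_mul_of_pos_right d (by omega)
    have h2 : (d * 100 + 100) * (2 * (n + 1) * X + n * m ^ d + n + 1) ≤ 200 * d * (6 * Y) :=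
      Nat.mul_le_mul (by omega) (by omega)
    have e2 : 200 * d * (6 * Y) = 1200 * (d * Y) := by ring
    set Z := d * Y
    have h3 : (d * 100 + 100) * (2 * (n + 1) * X + n * m ^ d + n + 1) + d * 50 + 70
      ≤ 1400 * Z := by omega
    have h4 := Nat.mul_le_mul_left s h3
    have h5 : Z ≤ s * Z := Nat.le_mul_of_pos_left Z hs1
    have e3 : s * (1400 * Z) = 1400 * (s * Z) := by ring
    omega
  have hX : ((m : ℝ) + 1) ^ d ≤ 3 * (2 * d / ε) ^ d := by
    have hmle : (m : ℝ) ≤ 2 * d / ε + 1 := by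
      rw [hm]
      exact (Nat.ceil_lt_add_one (by positivity)).le
    have e1 : ((m : ℝ) + 1) ≤ (2 * d / ε) * Real.exp (1 / d) := by
      have := Real.add_one_le_exp ((1 : ℝ) / d)
      have h2 : (2 * d / ε) * (1 / d + 1) ≤ (2 * d / ε) * Real.exp (1 / d) := by gcongr
      have e : (2 * d / ε) * (1 / d + 1) = 2 / ε + 2 * d / ε := by field_simp
      have h3 : 2 ≤ 2 / ε := by
        rw [le_div_iff₀ hε]
        linarith
      linarith
    calc ((m : ℝ) + 1) ^ d ≤ ((2 * d / ε) * Real.exp (1 / d)) ^ d := by gcongr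
      _ = (2 * d / ε) ^ d * Real.exp 1 := by
          rw [mul_pow, ← Real.exp_nat_mul, mul_one_div_cancel (by positivity)]
      _ ≤ (2 * d / ε) ^ d * 3 := by
          gcongr
          linarith [Real.exp_one_lt_d9]
      _ = _ := by ring
  have hs' : (s : ℝ) ≤ (Real.exp 1 * (7 / 2 * L / ε)) ^ d := by
    refine hs.trans ?_
    have h0 : 0 ≤ Real.log ((n : ℝ) + 1) := Real.log_nonneg (by linarith)
    gcongr
    rw [← sub_nonneg]
    have : 7 / 2 * L / ε - (1 + 2 * Real.log (n + 1) / ε)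
        = (7 / 2 * L - ε - 2 * Real.log (n + 1)) / ε := by
      field_simp
      ring
    rw [this]
    exact div_nonneg (by linarith) hε.le
  -- The slack between `7` and `8` absorbs the factor `d`.
  have hdpow : (d : ℝ) ≤ 7 * (8 / 7) ^ d := by
    have := one_add_mul_le_pow (a := (1 / 7 : ℝ)) (by norm_num) d
    norm_num at this ⊢
    linarith
  calc _ ≤ ((2000 * (s * (d * (n * (m + 1) ^ d))) : ℕ) : ℝ) := by exact_mod_cast h1
    _ = 2000 * (s * (d * (n * ((m : ℝ) + 1) ^ d))) := by push_cast; rfl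
    _ ≤ 2000 * ((Real.exp 1 * (7 / 2 * L / ε)) ^ d * (7 * (8 / 7) ^ d *
          (n * (3 * (2 * d / ε) ^ d)))) := by gcongr
    _ = 42000 * ((Real.exp 1 * (7 / 2 * L / ε) * (8 / 7) * (2 * d / ε)) ^ d * n) := by
        rw [mul_pow (Real.exp 1 * (7 / 2 * L / ε) * (8 / 7)), mul_pow (Real.exp 1 * (7 / 2 * L / ε))]
        ring
    _ = 42000 * ((8 * Real.exp 1 * d / ε ^ 2 * L) ^ d * n) := by
        congr 3
        field_simp
    _ = _ := by
        rw [mul_pow]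
        ring

end EmptyBox


theorem theorem4 :
    ∃ (P : RealRAM.Prog) (C : ℝ),
      ∀ (d n : ℕ) (ε : ℝ) (lo hi : Fin d → ℝ) (p : Fin n → Fin d → ℝ),
        1 ≤ d → 2 ≤ n → 0 < ε → ε < 1 →
        (∀ i, lo i < hi i) → (∀ j, p j ∈ Set.Icc lo hi) →
        ∀ σ : RealRAM.State, EmptyBox.HoldsInput σ ε lo hi p →
          ∃ (t : ℕ) (τ : RealRAM.State),
            RealRAM.Exec P σ t τ ∧
            (t : ℝ) ≤ C * ((8 * Real.exp 1 * d / ε ^ 2) ^ d * n * Real.logb 2 n ^ d) ∧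
            EmptyBox.IsApproxMaxEmptyBox ε lo hi p
              (EmptyBox.readPoint d τ 4) (EmptyBox.readPoint d τ 5) := by
  refine ⟨EmptyBox.largestEmptyBox, 42000, fun d n ε lo hi p hd hn hε hε1 hw _ σ hin => ?_⟩
  have hd' : (1 : ℝ) ≤ d := by exact_mod_cast hd
  obtain ⟨q, hqd⟩ : ∃ q : ℝ, q = 1 - ε / (2 * d) := ⟨_, rfl⟩
  obtain ⟨m, hm⟩ : ∃ m : ℕ, m = ⌈2 * d / ε⌉₊ := ⟨_, rfl⟩
  have hmle : 2 * d / ε ≤ m := by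
    rw [hm]
    exact Nat.le_ceil _
  have hm1 : 1 ≤ m := by
    have : (0 : ℝ) < m := lt_of_lt_of_le (by positivity) hmle
    exact_mod_cast this
  have ha : 0 < ε / (2 * d) := by positivity
  have ha1 : ε / (2 * d) < 1 := by
    rw [div_lt_one (by positivity)]
    linarith
  have hq : 0 < q := by linarith
  have hq1 : q < 1 := by linarith
  have hqpow : 1 / 2 ≤ q ^ d := by
    have := one_add_mul_le_pow (a := -(ε / (2 * d))) (by linarith) d
    have e : (1 : ℝ) + d * -(ε / (2 * d)) = 1 - ε / 2 := by field_simp; ring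
    rw [e, ← sub_eq_add_neg, ← hqd] at this
    linarith
  obtain ⟨S, hS, hcard⟩ := EmptyBox.exists_scales (n := n) hd (by omega) hε hε1
  rw [← hqd] at hS
  have hS1 : 1 ≤ S.card := Finset.card_pos.mpr ⟨0, (hS 0).mpr (by simp)⟩
  have hT : ∀ k ∈ S, ∏ i ∈ Finset.range d, EmptyBox.counts q k m i
      ≤ 2 * (n + 1) * (m + 1) ^ d := by
    intro k hk
    have h1 := EmptyBox.prod_counts_le (k := k) hm1 hq hq1.le
    have h2 := (hS k).mp hk
    have h3 : ((m : ℝ) + 1) ^ d / (q ^ (∑ i, k i) * q ^ d) ≤ 2 * (n + 1) * (m + 1) ^ d := by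
      rw [div_le_iff₀ (by positivity)]
      have h4 : 1 ≤ 2 * q ^ d * (((n : ℝ) + 1) * q ^ ∑ i, k i) :=
        one_le_mul_of_one_le_of_one_le (by linarith) h2
      calc ((m : ℝ) + 1) ^ d ≤ (m + 1) ^ d * (2 * q ^ d * (((n : ℝ) + 1) * q ^ ∑ i, k i)) :=
            le_mul_of_one_le_right (by positivity) h4
        _ = _ := by ring
    exact_mod_cast h1.trans h3
  obtain ⟨t, τ, hexec, ht, hbest⟩ :=
    EmptyBox.largestEmptyBox_runs hin hε hq hq1.le hqd hm hS hT
  refine ⟨t, τ, hexec, ?_, hbest.isApproxMaxEmptyBox hd hε hε1 hq hq1 hqd hmle hw hS⟩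
  exact le_trans (by exact_mod_cast ht) (EmptyBox.time_bound hd hn hε hε1 hm hS1 hcard)
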